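/- Let $q$ be an odd prime power, let $m\ge 12$ be an integer with $m\equiv 4 \pmod 8$, and let $n=q^m+1$. For $0\le s<n$ let $C_s=\{s q^j \bmod n : j\ge 0\}\subset \mathbb{Z}_n$ be the $q$-cyclotomic coset of $s$ modulo $n$; its smallest element (residues being represented by $0,\dots,n-1$) is its coset leader. Let $\delta_i$ denote the $i$-th largest coset leader modulo $n$. Put $$\Delta_2=\frac{(q-1)^2(q^2-1)\,n}{2(q^4+1)},\qquad \Delta_3=\frac{(q-1)^2(q^2-1)}{2(q^4+1)}\left(q^m-2q^{m-8}-1\right),$$ $$\Delta_4=\begin{cases}\Delta_3-q^2(q^2-1)(q-1)^2, & m=12,\\ \Delta_3-(q^4-1)(q^2-1)(q-1)^2, & m>12.\end{cases}$$ Then $\delta_1=\frac n2$, $\delta_2=\Delta_2$, $\delta_3=\Delta_3$, $\delta_4=\Delta_4$, and $|C_{\delta_2}|=8$, $|C_{\delta_3}|=|C_{\delta_4}|=2m$. Let further $\beta$ be a primitive $n$-th root of unity in an extension field of $\mathbb{F}_q$, and let $m_i(x)$ be the minimal polynomial of $\beta^i$ over $\mathbb{F}_q$. Let $\mathcal{C}_{(q,n,\delta+1,0)}\subseteq\mathbb{F}_q^n$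 be the BCH code, i.e. the cyclic code of length $n$ over $\mathbb{F}_q$ with generator polynomial $\operatorname{lcm}(m_0(x),m_1(x),\dots,m_{\delta-1}(x))$. For every integer $\delta$ with $\delta_4\le\delta\le\delta_1$ this code is LCD (it meets its Euclidean dual only in $0$), its minimum Hamming distance $d$ satisfies $d\ge 2\delta$, and its dimension is - $8i-7$ if $\delta_{i+1}+1\le\delta\le\delta_i$ ($i=1,2$); - $2m+9$ if $\delta_4+1\le\delta\le\delta_3$; - $4m+9$ if $\delta=\delta_4$. -/

import Mathlib

universe u v

open Polynomial

noncomputable section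

namespace LCDBCH

/-! ### Cyclotomic cosets -/

/-- The `q`-cyclotomic coset `{s, sq, sq², …}` of `s` modulo `n`, as a subset of `ℤ/nℤ`. -/
def cyclotomicCoset (q n s : ℕ) : Set (ZMod n) :=
  {x | ∃ j : ℕ, x = (s : ZMod n) * (q : ZMod n) ^ j}

/-- `s` is a coset leader modulo `n`: `0 ≤ s < n`, and `s` is the smallest element of its
`q`-cyclotomic coset, residues being represented by the integers `0, …, n - 1`. -/
def IsCosetLeader (q n s : ℕ) : Prop :=
  s < n ∧ ∀ x ∈ cyclotomicCoset q n s, s ≤ x.val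

/-- `s` is the `i`-th largest `q`-cyclotomic coset leader modulo `n` (for `i = 1, 2, …`): it is a
coset leader, and together with it there are exactly `i` coset leaders that are at least `s`. -/
def IsNthLargestCosetLeader (q n i s : ℕ) : Prop :=
  IsCosetLeader q n s ∧ {t : ℕ | IsCosetLeader q n t ∧ s ≤ t}.ncard = i

/-! ### The explicit values -/

/-- `Δ₂ = (q-1)²(q²-1)(q^m+1) / (2(q⁴+1))`. -/
def Delta2 (q m : ℕ) : ℚ :=
  ((q : ℚ) - 1) ^ 2 * ((q : ℚ) ^ 2 - 1) * ((q : ℚ) ^ m + 1) / (2 * ((q : ℚ) ^ 4 + 1))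

/-- `Δ₃ = (q-1)²(q²-1)/(2(q⁴+1)) · (q^m - 2q^(m-8) - 1)`; used for `8 ≤ m` only. -/
def Delta3 (q m : ℕ) : ℚ :=
  ((q : ℚ) - 1) ^ 2 * ((q : ℚ) ^ 2 - 1) / (2 * ((q : ℚ) ^ 4 + 1))
    * ((q : ℚ) ^ m - 2 * (q : ℚ) ^ (m - 8) - 1)

/-- `Δ₄`, with its separate value for `m = 12`. -/
def Delta4 (q m : ℕ) : ℚ :=
  if m = 12 then
    Delta3 q m - (q : ℚ) ^ 2 * ((q : ℚ) ^ 2 - 1) * ((q : ℚ) - 1) ^ 2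
  else
    Delta3 q m - ((q : ℚ) ^ 4 - 1) * ((q : ℚ) ^ 2 - 1) * ((q : ℚ) - 1) ^ 2

/-! ### Linear codes -/

section Codes

variable {F : Type*} [Field F] {n : ℕ}

/-- The Euclidean dual code. -/
def dualCode (C : Submodule F (Fin n → F)) : Submodule F (Fin n → F) where
  carrier := {x | ∀ y ∈ C, x ⬝ᵥ y = 0}
  zero_mem' := fun y _ => zero_dotProduct y
  add_mem' := fun {a b} ha hb y hy => by
    rw [add_dotProduct, ha y hy, hb y hy, add_zero]
  smul_mem' := fun c x hx y hy => by
    rw [smul_dotProduct, hx y hy, smul_zero]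

/-- Linear codes with complementary dual. -/
def IsLCD (C : Submodule F (Fin n → F)) : Prop :=
  C ⊓ dualCode C = ⊥

open Classical in
/-- The minimum (Hamming) distance of a code (with the value `0` for the zero code). -/
def minDist (C : Submodule F (Fin n → F)) : ℕ :=
  sInf {d : ℕ | ∃ x ∈ C, ∃ y ∈ C, x ≠ y ∧ hammingDist x y = d}

/-- The identification of a word `(c₀, …, cₙ₋₁)` with the class of `c₀ + c₁x + ⋯ + cₙ₋₁xⁿ⁻¹`
in `F[x]/(xⁿ - 1)`. -/
def wordClass (F : Type*) [Field F] (n : ℕ) :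
    (Fin n → F) →ₗ[F] AdjoinRoot ((X : F[X]) ^ n - 1) where
  toFun c := AdjoinRoot.mk ((X : F[X]) ^ n - 1) (∑ i : Fin n, C (c i) * X ^ (i : ℕ))
  map_add' a b := by
    simp [add_mul, Finset.sum_add_distrib]
  map_smul' r a := by
    simp [Algebra.smul_def, mul_assoc, Finset.mul_sum, AdjoinRoot.algebraMap_eq]

/-- The cyclic code `⟨g⟩` of length `n`: the words whose class in `F[x]/(xⁿ - 1)` lies in the
ideal generated by `g`. -/
def cyclicCode (n : ℕ) (g : F[X]) : Submodule F (Fin n → F) :=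
  Submodule.comap (wordClass F n)
    ((Ideal.span {AdjoinRoot.mk ((X : F[X]) ^ n - 1) g}).restrictScalars F)

end Codes

section BCH

variable (F : Type*) [Field F] {K : Type*} [Field K] [Algebra F K]

open Classical in
/-- `lcm(m_b(x), m_{b+1}(x), …, m_{b+δ-2}(x))`, the monic least common multiple in `F[x]`, where
`m_i(x)` is the minimal polynomial of `β^i` over `F`. -/
def bchGenerator (β : K) (δ : ℕ) (b : ℤ) : F[X] :=
  letI : NormalizedGCDMonoid F[X] := UniqueFactorizationMonoid.toNormalizedGCDMonoid F[X]
  (Finset.Icc b (b + (δ : ℤ) - 2)).lcm fun i => minpoly F (β ^ i)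

/-- The BCH code of length `n` over `F` with designed distance `δ` and first exponent `b`,
with respect to the primitive `n`-th root of unity `β`. -/
def bchCode (n : ℕ) (β : K) (δ : ℕ) (b : ℤ) : Submodule F (Fin n → F) :=
  cyclicCode n (bchGenerator F β δ b)

end BCH

end LCDBCH

end

/-! Write n = 2N. Since q is odd, multiplication by q fixes N modulo n, so a residue s is best
written as N - X 0 with X 0 a centred residue. Its orbit satisfies X (j+1) = q X j - n a j with |X
j| < n/2, and the digits a order the values X 0 lexicographically (`digit_le`, `lt_of_lexLT`). Since
q^m = -1 modulo n, both X and a change sign after m steps. Hence a residue s > 0 is a coset leader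
exactly when no signed shift of its word a exceeds a, and the largest leaders belong to the
lexicographically smallest such words. Determining them is a problem about words.

The zero word gives n/2. Let m = 4M, where M is odd. Any other maximal word up to the fourth one has
digits in {-1, 0, 1} and begins 1, 0, -1, 1, because smaller beginnings force a period dividing m
(`prefix_of_shiftsLE`). For M ≥ 5 it is then a chain of signed blocks 1, 0, -1, 1 and 1, 0, -1, 0,
the sign changing after each block of the first kind (`parse_blocks`). Antiperiodicity makes the
number of blocks of the first kind odd. Without blocks of the second kind ("zero blocks") the
antiperiod drops to 4; this is the second leader, with a coset of size 8. Otherwise two consecutive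
zero blocks are at an odd distance D, and the smaller D is, the larger is a suitable shift: D = M -
2 gives the third word and D = M - 4 the fourth (`blocks_classification`). For M = 5 this is a
finite check. For m = 12 there is no room for D = M - 4, and the fourth word is not made of blocks
(`classification₁₂`). The values follow from a linear recursion along the blocks (`deviation_succ`).

For the codes, the dimension is the number of residues whose coset leader is at least δ. The zeros
are closed under inversion because q^m = -1 modulo n. This gives the LCD property, and it turns the
zeros β^0, ..., β^(δ-1) into 2δ - 1 consecutive ones, to which the BCH bound applies. -/

noncomputable section

namespace LCDBCH

/-! ### Centred expansions -/

/-- `X` is an orbit of multiplication by `q` on centred residues modulo `n`, and `a` is its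
sequence of digits: `X (j + 1) = q * X j - n * a j`. -/
structure IsExpansion (q n : ℤ) (X a : ℕ → ℤ) : Prop where
  step : ∀ j, X (j + 1) = q * X j - n * a j
  lt : ∀ j, 2 * |X j| < n

/-- Strict lexicographic comparison of integer sequences. -/
def LexLT (a b : ℕ → ℤ) : Prop := ∃ k, (∀ j < k, a j = b j) ∧ a k < b k

namespace IsExpansion

variable {q n : ℤ} {X a Y b : ℕ → ℤ}

lemma shift (h : IsExpansion q n X a) (i : ℕ) :
    IsExpansion q n (fun j => X (i + j)) fun j => a (i + j) :=
  ⟨fun j => h.step (i + j), fun j => h.lt (i + j)⟩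

lemma smul (h : IsExpansion q n X a) {ε : ℤ} (hε : ε = 1 ∨ ε = -1) :
    IsExpansion q n (fun j => ε * X j) fun j => ε * a j := by
  refine ⟨fun j => ?_, fun j => ?_⟩
  · simp only [h.step j]; ring
  · rcases hε with rfl | rfl <;> simpa using h.lt j

lemma pos (h : IsExpansion q n X a) : 0 < n := by
  have := h.lt 0; have := abs_nonneg (X 0); omega

lemma sub_eq (hX : IsExpansion q n X a) (hY : IsExpansion q n Y b) {k : ℕ}
    (h : ∀ j < k, a j = b j) : X k - Y k = q ^ k * (X 0 - Y 0) := by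
  induction k with
  | zero => simp
  | succ k ih =>
    rw [hX.step, hY.step, h k (by omega), pow_succ]
    linear_combination q * ih fun j hj => h j (by omega)

/-- While the digits agree, the difference of the orbits is just multiplied by q, so X k ≤ Y k. The
next terms differ by less than n, which leaves no room for a larger digit a k. -/
lemma digit_le (hX : IsExpansion q n X a) (hY : IsExpansion q n Y b) (hq : 0 ≤ q) {k : ℕ}
    (h0 : X 0 ≤ Y 0) (h : ∀ j < k, a j = b j) : a k ≤ b k := by
  have h1 := hX.sub_eq hY h
  have h2 : X k ≤ Y k := by
    have : 0 ≤ q ^ k * (Y 0 - X 0) := mul_nonneg (pow_nonneg hq _) (by omega)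
    linarith
  have h3 := mul_le_mul_of_nonneg_left h2 hq
  have h4 := hX.step k
  have h5 := hY.step k
  have h6 := abs_lt.1 (show |X (k+1)| < n - |X (k+1)| by linarith [hX.lt (k+1)])
  have h7 := abs_lt.1 (show |Y (k+1)| < n - |Y (k+1)| by linarith [hY.lt (k+1)])
  have h8 := hX.lt (k+1)
  have h9 := hY.lt (k+1)
  have h10 := le_abs_self (Y (k+1))
  have h11 := neg_abs_le (X (k+1))
  have hn := hX.pos
  have : n * (a k - b k - 1) < 0 := by linarith
  have := (pos_iff_neg_of_mul_neg this).1 hn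
  omega

lemma lt_of_lexLT (hX : IsExpansion q n X a) (hY : IsExpansion q n Y b) (hq : 0 ≤ q)
    (h : LexLT a b) : X 0 < Y 0 := by
  obtain ⟨k, h1, h2⟩ := h
  by_contra h3
  have := hY.digit_le hX hq (not_lt.1 h3) (fun j hj => (h1 j hj).symm)
  omega

/-- A nonzero difference would grow like q^k, yet it stays below n. -/
lemma eq_of_digits (hX : IsExpansion q n X a) (hY : IsExpansion q n Y b) (hq : 2 ≤ q)
    (h : ∀ j, a j = b j) : X 0 = Y 0 := by
  have hn := hX.pos
  have h1 := hX.sub_eq hY (k := n.toNat) fun j _ => h j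
  have h2 : |X n.toNat - Y n.toNat| < n := by
    have := abs_sub (X n.toNat) (Y n.toNat)
    linarith [hX.lt n.toNat, hY.lt n.toNat]
  have h3 : n < q ^ n.toNat := by
    have : (n.toNat : ℤ) < 2 ^ n.toNat := by exact_mod_cast Nat.lt_two_pow_self
    calc n = (n.toNat : ℤ) := by omega
      _ < 2 ^ n.toNat := this
      _ ≤ q ^ n.toNat := by gcongr
  by_contra h4
  have h5 : 1 ≤ |X 0 - Y 0| := Int.one_le_abs (sub_ne_zero.2 h4)
  rw [h1, abs_mul, abs_of_pos (by positivity)] at h2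
  nlinarith

end IsExpansion

/-! ### Negacyclic words -/

/-- The value of the word `w j, …, w (j + m - 1)` in base `q`. -/
def wordValue (q : ℤ) (m : ℕ) (w : ℕ → ℤ) (j : ℕ) : ℤ :=
  ∑ k ∈ Finset.range m, w (j + k) * q ^ (m - 1 - k)

lemma wordValue_succ (q : ℤ) (m : ℕ) {w : ℕ → ℤ} (hw : ∀ j, w (j + m) = -w j) (j : ℕ) :
    wordValue q m w (j + 1) = q * wordValue q m w j - (q ^ m + 1) * w j := by
  rcases m with _ | m
  · have := hw j; simp only [add_zero] at this
    have : w j = 0 := by omega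
    simp [wordValue, this]
  · unfold wordValue
    rw [Finset.sum_range_succ, Finset.sum_range_succ' (fun k => w (j + k) * _), mul_add,
      Finset.mul_sum]
    have h1 : w (j + 1 + m) = -w j := by rw [← hw j]; congr 1; ring
    have h2 : ∀ k ∈ Finset.range m, w (j + 1 + k) * q ^ (m + 1 - 1 - k) =
        q * (w (j + (k + 1)) * q ^ (m + 1 - 1 - (k + 1))) := by
      intro k hk
      have hk := Finset.mem_range.1 hk
      have : m + 1 - 1 - k = (m + 1 - 1 - (k + 1)) + 1 := by omega
      rw [this, pow_succ, show j + 1 + k = j + (k + 1) by ring]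
      ring
    rw [Finset.sum_congr rfl h2, h1]
    simp only [Nat.add_sub_cancel, Nat.sub_self, Nat.sub_zero, add_zero]
    ring

/-- The converse construction: unrolling an antiperiodic expansion over m steps leaves no other
value than `wordValue`. The bound rests on q ≥ 3, which gives 2(q^m - 1)/(q - 1) ≤ q^m - 1. -/
lemma isExpansion_wordValue {q : ℤ} (hq : 3 ≤ q) {m : ℕ} {w : ℕ → ℤ}
    (hw : ∀ j, w (j + m) = -w j) (h1 : ∀ j, |w j| ≤ 1) :
    IsExpansion q (q ^ m + 1) (wordValue q m w) w := by
  refine ⟨wordValue_succ q m hw, fun j => ?_⟩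
  have h2 : |wordValue q m w j| ≤ ∑ k ∈ Finset.range m, q ^ (m - 1 - k) := by
    refine (Finset.abs_sum_le_sum_abs _ _).trans (Finset.sum_le_sum fun k _ => ?_)
    have : 0 ≤ q ^ (m - 1 - k) := by positivity
    rw [abs_mul, abs_of_nonneg this]
    nlinarith [h1 (j + k)]
  rw [Finset.sum_range_reflect (fun k => q ^ k) m] at h2
  have h3 := geom_sum_mul q m
  have h4 : 0 ≤ ∑ k ∈ Finset.range m, q ^ k := Finset.sum_nonneg fun k _ => by positivity
  nlinarith

/-! ### Block words -/

/-- The block `1, 0, -1, 1` (for `false`) or `1, 0, -1, 0` (for `true`). -/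
def block (c : Bool) (r : ℕ) : ℤ :=
  if r = 0 then 1 else if r = 1 then 0 else if r = 2 then -1 else if c then 0 else 1

/-- The sign of the `j`-th block: it changes after each block `1, 0, -1, 1`. -/
def blockSign (c : ℕ → Bool) (j : ℕ) : ℤ := ∏ i ∈ Finset.range j, if c i then 1 else -1

/-- The concatenation of the signed blocks given by `c`. -/
def blockWord (c : ℕ → Bool) (k : ℕ) : ℤ := blockSign c (k / 4) * block (c (k / 4)) (k % 4)

variable {c : ℕ → Bool}

@[simp] lemma blockSign_zero : blockSign c 0 = 1 := by simp [blockSign]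

lemma blockSign_succ (j : ℕ) :
    blockSign c (j + 1) = blockSign c j * if c j then 1 else -1 := by
  simp [blockSign, Finset.prod_range_succ]

lemma blockSign_succ_of_true {j : ℕ} (h : c j = true) : blockSign c (j + 1) = blockSign c j := by
  simp [blockSign_succ, h]

lemma blockSign_succ_of_false {j : ℕ} (h : c j = false) :
    blockSign c (j + 1) = -blockSign c j := by
  simp [blockSign_succ, h]

lemma blockSign_eq_or (c : ℕ → Bool) (j : ℕ) : blockSign c j = 1 ∨ blockSign c j = -1 := by
  induction j with
  | zero => simp
  | succ j ih => rw [blockSign_succ]; cases c j <;> simp <;> omega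

lemma blockSign_mul_self (c : ℕ → Bool) (j : ℕ) : blockSign c j * blockSign c j = 1 := by
  rcases blockSign_eq_or c j with h | h <;> simp [h]

lemma blockSign_add (c : ℕ → Bool) (p j : ℕ) :
    blockSign c (p + j) = blockSign c p * blockSign (fun i => c (p + i)) j := by
  simp [blockSign, Finset.prod_range_add]

lemma blockSign_congr {c c' : ℕ → Bool} {j : ℕ} (h : ∀ i < j, c i = c' i) :
    blockSign c j = blockSign c' j :=
  Finset.prod_congr rfl fun i hi => by rw [h i (Finset.mem_range.1 hi)]

lemma blockWord_mul_add (c : ℕ → Bool) (p : ℕ) {r : ℕ} (hr : r < 4) :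
    blockWord c (4 * p + r) = blockSign c p * block (c p) r := by
  unfold blockWord
  rw [show (4 * p + r) / 4 = p by omega, show (4 * p + r) % 4 = r by omega]

lemma abs_blockWord_le (c : ℕ → Bool) (k : ℕ) : |blockWord c k| ≤ 1 := by
  unfold blockWord
  rw [abs_mul]
  rcases blockSign_eq_or c (k / 4) with h | h <;> rw [h] <;> unfold block <;> split_ifs <;> simp

lemma blockWord_shift (c : ℕ → Bool) (p k : ℕ) :
    blockWord c (4 * p + k) = blockSign c p * blockWord (fun i => c (p + i)) k := by
  unfold blockWord
  rw [show (4 * p + k) / 4 = p + k / 4 by omega, show (4 * p + k) % 4 = k % 4 by omega,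
    blockSign_add, mul_assoc]

lemma blockWord_congr {c c' : ℕ → Bool} {k : ℕ} (h : ∀ i, 4 * i ≤ k → c i = c' i) :
    blockWord c k = blockWord c' k := by
  unfold blockWord
  rw [blockSign_congr fun i hi => h i (by omega), h _ (by omega)]

lemma blockWord_add_period {M : ℕ} (hc : ∀ j, c (j + M) = c j) (hM : blockSign c M = -1) (k : ℕ) :
    blockWord c (k + 4 * M) = -blockWord c k := by
  rw [add_comm, blockWord_shift, hM, neg_one_mul]
  simp only [add_comm M, hc]

/-- Comparison of two block words at the first block where they differ. -/
lemma blockWord_lexLT {c c' : ℕ → Bool} {J : ℕ} (h : ∀ j < J, c j = c' j)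
    (hJ : c J ≠ c' J) (hs : blockSign c J = if c J then 1 else -1) :
    LexLT (blockWord c) (blockWord c') := by
  have hs' : blockSign c' J = blockSign c J := (blockSign_congr h).symm
  refine ⟨4 * J + 3, fun j hj => ?_, ?_⟩
  · rcases lt_or_ge j (4 * J) with h1 | h1
    · exact blockWord_congr fun i hi => h i (by omega)
    · obtain ⟨r, rfl⟩ := Nat.exists_eq_add_of_le h1
      have hr : r < 3 := by omega
      rw [blockWord_mul_add _ _ (by omega), blockWord_mul_add _ _ (by omega), hs']
      interval_cases r <;> simp [block]
  · rw [blockWord_mul_add _ _ (by omega), blockWord_mul_add _ _ (by omega), hs', hs]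
    cases h1 : c J <;> cases h2 : c' J <;> simp_all [block]

/-- All signed shifts of `w` by `0 < i < L` are strictly smaller than `w`. -/
def StrictMaximal (L : ℕ) (w : ℕ → ℤ) : Prop :=
  ∀ i, 0 < i → i < L → ∀ ε : ℤ, ε = 1 ∨ ε = -1 → LexLT (fun k => ε * w (i + k)) w

/-- A signed shift that starts inside a block, or at a block with the wrong sign, falls below 1, 0,
-1, 1 within four digits. Hence only sign-normalised shifts by whole blocks compete for the maximum.
-/
lemma blockWord_lexLT_of_not_aligned {b c : ℕ → Bool} (hc : c 0 = false) {ε : ℤ}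
    (hε : ε = 1 ∨ ε = -1) {r : ℕ} (hr : r < 4) (h : r = 0 → ε = -1) :
    LexLT (fun k => ε * blockWord b (r + k)) (blockWord c) := by
  have c0 : ∀ x < 4, blockWord c x = block false x := by
    intro x hx
    have := blockWord_mul_add c 0 hx
    simpa [hc] using this
  have b0 : ∀ x < 4, blockWord b x = block (b 0) x := by
    intro x hx
    have := blockWord_mul_add b 0 hx
    simpa using this
  have b1 : ∀ x < 4, blockWord b (4 + x) = (if b 0 then 1 else -1) * block (b 1) x := by
    intro x hx
    have := blockWord_mul_add b 1 hx
    simpa [blockSign_succ] using this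
  have e0 := b0 0; have e1 := b0 1; have e2 := b0 2; have e3 := b0 3
  have e4 := b1 0; have e5 := b1 1
  have f0 := c0 0; have f1 := c0 1; have f2 := c0 2; have f3 := c0 3
  interval_cases r
  · exact ⟨0, by simp, by simp [f0, e0, h rfl, block]⟩
  · refine ⟨0, by simp, ?_⟩
    simp [f0, e1, block]
  · rcases hε with rfl | rfl
    · exact ⟨0, by simp, by simp [f0, e2, block]⟩
    · cases hb : b 0
      · refine ⟨1, fun j hj => ?_, ?_⟩
        · interval_cases j; simp [e2, f0, block]
        · simp [e3, f1, block, hb]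
      · refine ⟨3, fun j hj => ?_, ?_⟩
        · interval_cases j
          · simp [e2, f0, block]
          · simp [e3, f1, block, hb]
          · simp [e4, f2, block, hb]
        · simp [e5, f3, block]
  · cases hb : b 0
    · rcases hε with rfl | rfl
      · refine ⟨1, fun j hj => ?_, ?_⟩
        · interval_cases j; simp [e3, f0, block, hb]
        · simp [e4, f1, block, hb]
      · exact ⟨0, by simp, by simp [f0, e3, block, hb]⟩
    · exact ⟨0, by simp, by simp [f0, e3, block, hb]⟩

lemma strictMaximal_blockWord {c : ℕ → Bool} {M : ℕ} (hc : c 0 = false)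
    (h : ∀ p, 0 < p → p < M → LexLT (blockWord fun i => c (p + i)) (blockWord c)) :
    StrictMaximal (4 * M) (blockWord c) := by
  intro i h0 hi ε hε
  obtain ⟨p, r, hr, rfl⟩ : ∃ p r, r < 4 ∧ i = 4 * p + r :=
    ⟨i / 4, i % 4, Nat.mod_lt _ (by norm_num), by omega⟩
  have key : (fun k => ε * blockWord c (4 * p + r + k)) =
      fun k => (ε * blockSign c p) * blockWord (fun i => c (p + i)) (r + k) := by
    funext k
    rw [add_assoc, blockWord_shift, mul_assoc]
  rw [key]
  have hs : ε * blockSign c p = 1 ∨ ε * blockSign c p = -1 := by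
    rcases hε with rfl | rfl <;> rcases blockSign_eq_or c p with h | h <;> simp [h]
  by_cases hr0 : r = 0 ∧ ε * blockSign c p = 1
  · rw [hr0.2, hr0.1]
    simpa using h p (by omega) (by omega)
  · exact blockWord_lexLT_of_not_aligned hc hs hr fun h => by
      rcases hs with h' | h'
      · exact absurd ⟨h, h'⟩ hr0
      · exact h'

/-! ### The extremal words -/

/-- Blocks of the third word. -/
def blocks₃ (M j : ℕ) : Bool := decide (j % M = 1 ∨ j % M = M - 1)

/-- Blocks of the fourth word. -/
def blocks₄ (M j : ℕ) : Bool := decide (j % M = 1 ∨ j % M = M - 3)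

lemma blocks₃_add (M j : ℕ) : blocks₃ M (j + M) = blocks₃ M j := by simp [blocks₃]

lemma blocks₄_add (M j : ℕ) : blocks₄ M (j + M) = blocks₄ M j := by simp [blocks₄]

lemma blockSign_of_run {c : ℕ → Bool} {a k : ℕ} (h : ∀ j, a ≤ j → j < a + k → c j = false) :
    blockSign c (a + k) = blockSign c a * (-1) ^ k := by
  induction k with
  | zero => simp
  | succ k ih =>
    rw [← add_assoc, blockSign_succ_of_false (h _ (by omega) (by omega)),
      ih fun j h1 h2 => h j h1 (by omega), pow_succ]
    ring

lemma blockSign_two {c : ℕ → Bool} (h0 : c 0 = false) (h1 : c 1 = true) : blockSign c 2 = -1 := by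
  simp [blockSign_succ, h0, h1]

lemma lexLT_of_blocks_zero {b c : ℕ → Bool} (hc0 : c 0 = false) (hb : b 0 = true) :
    LexLT (blockWord b) (blockWord c) :=
  blockWord_lexLT (J := 0) (by simp) (by simp [hc0, hb]) (by simp [hb])

lemma lexLT_of_blocks_one {b c : ℕ → Bool} (hc0 : c 0 = false) (hc1 : c 1 = true)
    (hb0 : b 0 = false) (hb : b 1 = false) : LexLT (blockWord b) (blockWord c) := by
  refine blockWord_lexLT (J := 1) (fun j hj => ?_) (by simp [hc1, hb]) (by simp [blockSign_succ, hb0, hb])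
  interval_cases j
  rw [hb0, hc0]

lemma strictMaximal_blocks₃ {M : ℕ} (hM : 3 ≤ M) (hodd : Odd M) :
    StrictMaximal (4 * M) (blockWord (blocks₃ M)) := by
  have c0 : blocks₃ M 0 = false := by simp [blocks₃]; omega
  have c1 : blocks₃ M 1 = true := by simp [blocks₃, Nat.mod_eq_of_lt (show 1 < M by omega)]
  refine strictMaximal_blockWord c0 fun p hp0 hp => ?_
  cases hb0 : blocks₃ M (p + 0)
  · cases hb1 : blocks₃ M (p + 1)
    · exact lexLT_of_blocks_one c0 c1 hb0 hb1
    · simp only [blocks₃, decide_eq_true_eq, decide_eq_false_iff_not, add_zero,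
        Nat.mod_eq_of_lt hp] at hb0 hb1
      -- Besides p = 0, the beginning false, true occurs only at the second zero block.
      have hp2 : p + 2 = M := by
        rcases Nat.lt_or_ge (p + 1) M with h | h
        · rw [Nat.mod_eq_of_lt h] at hb1; omega
        · omega
      have v0 : ∀ i, blocks₃ M (p + (i + 2)) = blocks₃ M i := fun i => by
        rw [← blocks₃_add M i]; congr 1; omega
      have hp1 : blocks₃ M (p + 1) = true := by
        simp [blocks₃, Nat.mod_eq_of_lt (show p + 1 < M by omega)]; omega
      have hp0 : blocks₃ M (p + 0) = false := by
        simp [blocks₃, Nat.mod_eq_of_lt hp]; omega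
      have hM4 : ∀ i, i < M → (blocks₃ M i = decide (i = 1 ∨ i = M - 1)) := fun i hi => by
        simp [blocks₃, Nat.mod_eq_of_lt hi]
      have hM5 : 5 ≤ M := by obtain ⟨k, rfl⟩ := hodd; omega
      have c2 : blocks₃ M 2 = false := by rw [hM4 2 (by omega)]; simp; omega
      have c3 : blocks₃ M 3 = false := by rw [hM4 3 (by omega)]; simp; omega
      -- The comparison is false, true, false, true against false, true, false, false. The sign at
      -- block 3 is positive, so the zero block is the smaller one.
      refine blockWord_lexLT (J := 3) (fun j hj => ?_) ?_ ?_
      · interval_cases j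
        · rw [hp0, c0]
        · rw [hp1, c1]
        · rw [v0 0, c0, c2]
      · simp only [v0 1, c1, c3]; decide
      · have := v0 0
        have := v0 1
        simp_all [blockSign_succ]
  · exact lexLT_of_blocks_zero c0 hb0

lemma strictMaximal_blocks₄ {M : ℕ} (hM : 5 ≤ M) (hodd : Odd M) :
    StrictMaximal (4 * M) (blockWord (blocks₄ M)) := by
  have c0 : blocks₄ M 0 = false := by simp [blocks₄]; omega
  have c1 : blocks₄ M 1 = true := by simp [blocks₄, Nat.mod_eq_of_lt (show 1 < M by omega)]
  refine strictMaximal_blockWord c0 fun p hp0 hp => ?_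
  cases hb0 : blocks₄ M (p + 0)
  · cases hb1 : blocks₄ M (p + 1)
    · exact lexLT_of_blocks_one c0 c1 hb0 hb1
    · simp only [blocks₄, decide_eq_true_eq, decide_eq_false_iff_not, add_zero,
        Nat.mod_eq_of_lt hp] at hb0 hb1
      have hp2 : p + 4 = M := by
        rcases Nat.lt_or_ge (p + 1) M with h | h
        · rw [Nat.mod_eq_of_lt h] at hb1; omega
        · obtain rfl : p = M - 1 := by omega
          rw [show M - 1 + 1 = M by omega, Nat.mod_self] at hb1
          omega
      have hM7 : 7 ≤ M := by obtain ⟨k, rfl⟩ := hodd; omega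
      have hM4 : ∀ i, i < M → (blocks₄ M i = decide (i = 1 ∨ i = M - 3)) := fun i hi => by
        simp [blocks₄, Nat.mod_eq_of_lt hi]
      have v : ∀ i, blocks₄ M (p + (i + 4)) = blocks₄ M i := fun i => by
        rw [← blocks₄_add M i]; congr 1; omega
      have b0 : blocks₄ M (p + 0) = false := by rw [hM4 _ (by omega)]; simp; omega
      have b1 : blocks₄ M (p + 1) = true := by rw [hM4 _ (by omega)]; simp; omega
      have b2 : blocks₄ M (p + 2) = false := by rw [hM4 _ (by omega)]; simp; omega
      have b3 : blocks₄ M (p + 3) = false := by rw [hM4 _ (by omega)]; simp; omega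
      have b4 := v 0
      have b5 := v 1
      have c2 : blocks₄ M 2 = false := by rw [hM4 2 (by omega)]; simp; omega
      have c3 : blocks₄ M 3 = false := by rw [hM4 3 (by omega)]; simp; omega
      rw [c0] at b4
      rw [c1] at b5
      have c4 := hM4 4 (by omega)
      have c5 := hM4 5 (by omega)
      -- The shift has its zero blocks at 1 and 5. For M = 7 the word itself has one at 4 already,
      -- where the sign is negative and a zero block is larger; for greater M the first difference
      -- is at 5, where the sign is positive and the zero block of the shift is smaller.
      by_cases h7 : M = 7
      · simp [h7] at c4
        simp only [← h7] at c4
        refine blockWord_lexLT (J := 4) (fun j hj => ?_) ?_ ?_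
        · interval_cases j <;> simp_all
        · simp_all
        · simp_all [blockSign_succ]
      · have c4' : blocks₄ M 4 = false := by rw [c4]; simp; omega
        have c5' : blocks₄ M 5 = false := by
          rw [c5]; obtain ⟨k, rfl⟩ := hodd; simp; omega
        refine blockWord_lexLT (J := 5) (fun j hj => ?_) ?_ ?_
        · interval_cases j <;> simp_all
        · simp_all
        · simp_all [blockSign_succ]
  · exact lexLT_of_blocks_zero c0 hb0

lemma strictMaximal_blocks₂ : StrictMaximal 4 (blockWord fun _ => false) :=
  strictMaximal_blockWord (M := 1) rfl fun p h0 h1 => by omega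

lemma blockSign_blocks₃ {M : ℕ} (hM : 3 ≤ M) (hodd : Odd M) :
    blockSign (blocks₃ M) M = -1 := by
  have hM4 : ∀ i, i < M → (blocks₃ M i = decide (i = 1 ∨ i = M - 1)) := fun i hi => by
    simp [blocks₃, Nat.mod_eq_of_lt hi]
  have h2 : blockSign (blocks₃ M) 2 = -1 := by
    apply blockSign_two
    · rw [hM4 _ (by omega)]; simp; omega
    · rw [hM4 _ (by omega)]; simp
  have h3 := blockSign_of_run (c := blocks₃ M) (a := 2) (k := M - 3) fun j h1 h2 => by
    rw [hM4 _ (by omega)]; simp; omega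
  have h4 := blockSign_succ_of_true (c := blocks₃ M) (j := 2 + (M - 3)) (by
    rw [hM4 _ (by omega)]; simp; omega)
  rw [show 2 + (M - 3) + 1 = M by omega, h3, h2, Even.neg_one_pow] at h4
  · simpa using h4
  · obtain ⟨k, rfl⟩ := hodd; exact ⟨k - 1, by omega⟩

lemma blockSign_blocks₄ {M : ℕ} (hM : 5 ≤ M) (hodd : Odd M) :
    blockSign (blocks₄ M) M = -1 := by
  have hM4 : ∀ i, i < M → (blocks₄ M i = decide (i = 1 ∨ i = M - 3)) := fun i hi => by
    simp [blocks₄, Nat.mod_eq_of_lt hi]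
  have h2 : blockSign (blocks₄ M) 2 = -1 := by
    apply blockSign_two
    · rw [hM4 _ (by omega)]; simp; omega
    · rw [hM4 _ (by omega)]; simp
  have h3 := blockSign_of_run (c := blocks₄ M) (a := 2) (k := M - 5) fun j h1 h2 => by
    rw [hM4 _ (by omega)]; simp; omega
  have h4 := blockSign_succ_of_true (c := blocks₄ M) (j := 2 + (M - 5)) (by
    rw [hM4 _ (by omega)]; simp; omega)
  have h5 := blockSign_of_run (c := blocks₄ M) (a := 2 + (M - 5) + 1) (k := 2) fun j h1 h2 => by
    rw [hM4 _ (by omega)]; simp; omega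
  rw [show 2 + (M - 5) + 1 + 2 = M by omega, h4, h3, h2, Even.neg_one_pow (n := M - 5)] at h5
  · simpa using h5
  · obtain ⟨k, rfl⟩ := hodd; exact ⟨k - 2, by omega⟩

/-! ### Values of block words -/

section Values

variable {q n : ℤ} {X a : ℕ → ℤ} {c : ℕ → Bool}

/-- The normalised deviation of a block word from the word without zero blocks. -/
def deviation (q n : ℤ) (X : ℕ → ℤ) (c : ℕ → Bool) (j : ℕ) : ℤ :=
  blockSign c j * X (4 * j) * (q ^ 4 + 1) - n * (q ^ 3 - q + 1)

/-- The value n(q³ - q + 1)/(q⁴ + 1) is the fixed point of the affine map attached to a block 1, 0,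
-1, 1, so that map is linear in the deviation. For a zero block the constant term comes from q⁴ + 1
- 2(q³ - q + 1) = (q - 1)²(q² - 1). -/
lemma deviation_succ (h : IsExpansion q n X (blockWord c)) (j : ℕ) :
    deviation q n X c (j + 1) = if c j then
      q ^ 4 * deviation q n X c j + n * ((q - 1) ^ 2 * (q ^ 2 - 1))
      else -q ^ 4 * deviation q n X c j := by
  have s0 := h.step (4 * j)
  have s1 := h.step (4 * j + 1)
  have s2 := h.step (4 * j + 2)
  have s3 := h.step (4 * j + 3)
  rw [show blockWord c (4 * j) = _ from blockWord_mul_add c j (r := 0) (by omega)] at s0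
  rw [blockWord_mul_add c j (by omega)] at s1 s2 s3
  simp only [add_assoc, Nat.reduceAdd] at s0 s1 s2 s3
  have h4 : X (4 * (j + 1)) = q ^ 4 * X (4 * j)
      - n * blockSign c j * (q ^ 3 - q + if c j then 0 else 1) := by
    rw [mul_add, mul_one, s3, s2, s1, s0]
    simp only [block]
    cases c j <;> simp <;> ring
  have h5 := blockSign_mul_self c j
  unfold deviation
  rw [h4, blockSign_succ]
  cases c j <;> simp
  · linear_combination (n * (q ^ 3 - q + 1) * (q ^ 4 + 1)) * h5
  · linear_combination (-n * (q ^ 3 - q) * (q ^ 4 + 1)) * h5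

lemma deviation_run (h : IsExpansion q n X (blockWord c)) {a k : ℕ} (hk : Even k)
    (h0 : ∀ j, a ≤ j → j < a + k → c j = false) :
    deviation q n X c (a + k) = q ^ (4 * k) * deviation q n X c a := by
  have : deviation q n X c (a + k) = (-q ^ 4) ^ k * deviation q n X c a := by
    clear hk
    induction k with
    | zero => simp
    | succ k ih =>
      rw [← add_assoc, deviation_succ h, h0 _ (by omega) (by omega),
        ih fun j h1 h2 => h0 j h1 (by omega)]
      simp only [Bool.false_eq_true, if_false]
      ring
  rw [this, hk.neg_pow, pow_mul]

end Values

/-! ### Cosets and expansions -/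

section Cosets

variable {q n N s : ℕ} {X a : ℕ → ℤ}

/-- Since q is odd, N q^j = N modulo n, so multiplication by q on s = N - X 0 acts on X alone. The
order is reversed: large residues have small X. -/
lemma coset_val (hq : Odd q) (hn : n = 2 * N) (h : IsExpansion q n X a)
    (hs : (s : ℤ) = N - X 0) (j : ℕ) :
    (((s : ZMod n) * (q : ZMod n) ^ j).val : ℤ) = N - X j := by
  have hn0 := h.pos
  have : NeZero n := ⟨by rintro rfl; simp at hn0⟩
  have h1 : ((X j : ℤ) : ZMod n) = (q : ZMod n) ^ j * ((X 0 : ℤ) : ZMod n) := by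
    induction j with
    | zero => simp
    | succ j ih => rw [h.step]; push_cast; rw [ih]; simp; ring
  have h2 : (N : ZMod n) * (q : ZMod n) ^ j = N := by
    obtain ⟨k, hk⟩ := hq.pow (n := j)
    have : N * q ^ j = n * k + N := by rw [hk, hn]; ring
    have := congrArg (Nat.cast : ℕ → ZMod n) this
    push_cast at this
    simpa using this
  have h3 : (s : ZMod n) * (q : ZMod n) ^ j = ((N - X j : ℤ) : ZMod n) := by
    have h4 : (s : ZMod n) = ((N - X 0 : ℤ) : ZMod n) := by rw [← hs]; simp
    rw [h4]; push_cast; rw [sub_mul, h2, h1]; ring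
  have h5 := h.lt j
  have h6 := neg_abs_le (X j)
  have h7 := le_abs_self (X j)
  rw [h3, ZMod.val_intCast, Int.emod_eq_of_lt (by omega) (by omega)]

lemma isCosetLeader_iff (hq : Odd q) (hn : n = 2 * N) (h : IsExpansion q n X a)
    (hs : (s : ℤ) = N - X 0) : IsCosetLeader q n s ↔ ∀ j, X j ≤ X 0 := by
  constructor
  · intro hl j
    have h1 := hl.2 _ ⟨j, rfl⟩
    have h2 := coset_val hq hn h hs j
    omega
  · intro hX
    refine ⟨?_, ?_⟩
    · have := h.lt 0; have := neg_abs_le (X 0); omega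
    · rintro _ ⟨j, rfl⟩
      have h2 := coset_val hq hn h hs j
      have := hX j
      omega

lemma exists_expansion_of_leader (hq : Odd q) (hn : n = 2 * N) (hs0 : 0 < s)
    (hl : IsCosetLeader q n s) {m : ℕ} (hm : n = q ^ m + 1) :
    ∃ X a : ℕ → ℤ, IsExpansion q n X a ∧ (s : ℤ) = N - X 0 ∧ (∀ j, X (j + m) = -X j) ∧
      ∀ j, a (j + m) = -a j := by
  have : NeZero n := ⟨by have := hl.1; omega⟩
  set y : ℕ → ZMod n := fun j => (s : ZMod n) * (q : ZMod n) ^ j with hy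
  set X : ℕ → ℤ := fun j => N - ((y j).val : ℤ) with hX
  have h0 : ∀ j, s ≤ (y j).val := fun j => hl.2 _ ⟨j, rfl⟩
  have h1 : ∀ j, (y j).val < n := fun j => ZMod.val_lt _
  have hlt : ∀ j, 2 * |X j| < n := fun j => by
    have := h0 j; have := h1 j
    have : |X j| < N := abs_lt.2 ⟨by simp only [hX]; omega, by simp only [hX]; omega⟩
    omega
  have hcast : ∀ j, ((X j : ℤ) : ZMod n) = N - y j := fun j => by simp [hX]
  have hNq : (N : ZMod n) * q = N := by
    obtain ⟨k, hk⟩ := hq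
    have : N * q = n * k + N := by rw [hk, hn]; ring
    have := congrArg (Nat.cast : ℕ → ZMod n) this
    push_cast at this
    simpa using this
  have hdvd : ∀ j, (n : ℤ) ∣ q * X j - X (j + 1) := fun j => by
    rw [← ZMod.intCast_zmod_eq_zero_iff_dvd]
    push_cast
    rw [hcast, hcast]
    have : y (j + 1) = y j * q := by simp [hy, pow_succ, mul_assoc]
    rw [this]
    linear_combination hNq
  choose a ha using hdvd
  have hstep : ∀ j, X (j + 1) = q * X j - n * a j := fun j => by linarith [ha j]
  have hanti : ∀ j, X (j + m) = -X j := fun j => by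
    have : (n : ℤ) ∣ X (j + m) + X j := by
      rw [← ZMod.intCast_zmod_eq_zero_iff_dvd]
      push_cast
      rw [hcast, hcast]
      have h2 : (q : ZMod n) ^ m = -1 := by
        have := congrArg (Nat.cast : ℕ → ZMod n) hm
        push_cast at this
        rw [ZMod.natCast_self] at this
        linear_combination -this
      have h3 : y (j + m) = -y j := by simp [hy, pow_add, h2]
      have h4 : (2 : ZMod n) * N = 0 := by
        have := congrArg (Nat.cast : ℕ → ZMod n) hn
        push_cast at this
        rw [ZMod.natCast_self] at this
        exact this.symm
      rw [h3]
      linear_combination h4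
    have h5 := Int.eq_zero_of_abs_lt_dvd this (by
      have := abs_add_le (X (j + m)) (X j); linarith [hlt j, hlt (j + m)])
    omega
  refine ⟨X, a, ⟨hstep, hlt⟩, ?_, hanti, fun j => ?_⟩
  · have : (y 0).val = s := by simp [hy, ZMod.val_natCast, Nat.mod_eq_of_lt hl.1]
    simp only [hX, this]
    ring
  · have h6 := hstep j
    have h7 := hstep (j + m)
    rw [show j + m + 1 = j + 1 + m by ring, hanti, hanti] at h7
    have hn0 : (n : ℤ) ≠ 0 := by exact_mod_cast NeZero.ne n
    have : (n : ℤ) * (a (j + m) + a j) = 0 := by linarith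
    have := (mul_eq_zero.1 this).resolve_left hn0
    omega

lemma abs_lt_of_strictMaximal (h : IsExpansion q n X a) {L : ℕ} (hw : StrictMaximal L a)
    {i : ℕ} (h0 : 0 < i) (hi : i < L) : |X i| < X 0 := by
  have h1 : ∀ ε : ℤ, ε = 1 ∨ ε = -1 → ε * X i < X 0 := fun ε hε => by
    have := ((h.shift i).smul hε).lt_of_lexLT h (by positivity) (hw i h0 hi ε hε)
    simpa using this
  have h2 := h1 1 (by simp)
  have h3 := h1 (-1) (by simp)
  exact abs_lt.2 ⟨by omega, by omega⟩

lemma abs_le_of_strictMaximal (h : IsExpansion q n X a) {L : ℕ} (hL : 0 < L)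
    (hw : StrictMaximal L a) (hX0 : 0 < X 0) (hX : ∀ j, X (j + L) = -X j) (j : ℕ) :
    |X j| ≤ X 0 := by
  have hmod : ∀ k i, |X (i + k * L)| = |X i| := fun k i => by
    induction k with
    | zero => simp
    | succ k ih => rw [Nat.succ_mul, ← add_assoc, hX, abs_neg, ih]
  have := hmod (j / L) (j % L)
  rw [mul_comm, Nat.mod_add_div] at this
  rw [this]
  rcases Nat.eq_zero_or_pos (j % L) with h0 | h0
  · rw [h0, abs_of_pos hX0]
  · exact (abs_lt_of_strictMaximal h hw h0 (Nat.mod_lt _ hL)).le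

/-- Strict maximality makes X 0 larger than every X d with 0 < d < 2L, the second half by
antiperiodicity. Any coincidence in the orbit can be shifted to one with X 0. -/
lemma ncard_cyclotomicCoset (hq : Odd q) (hn : n = 2 * N) (h : IsExpansion q n X a)
    (hs : (s : ℤ) = N - X 0) {L : ℕ} (hL : 0 < L) (hw : StrictMaximal L a) (hX0 : 0 < X 0)
    (hX : ∀ j, X (j + L) = -X j) : (cyclotomicCoset q n s).ncard = 2 * L := by
  have hn0 := h.pos
  have : NeZero n := ⟨by rintro rfl; simp at hn0⟩
  set y : ℕ → ZMod n := fun j => (s : ZMod n) * (q : ZMod n) ^ j with hy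
  have hval : ∀ j, ((y j).val : ℤ) = N - X j := coset_val hq hn h hs
  have hyX : ∀ i j, y i = y j ↔ X i = X j := fun i j => by
    rw [← (ZMod.val_injective n).eq_iff]
    have := hval i; have := hval j
    omega
  have hper : ∀ j, y (j + 2 * L) = y j := fun j => by
    rw [hyX, two_mul, ← add_assoc, hX, hX, neg_neg]
  have hperk : ∀ k j, y (j + k * (2 * L)) = y j := fun k j => by
    induction k with
    | zero => simp
    | succ k ih => rw [Nat.succ_mul, ← add_assoc, hper, ih]
  have hne : ∀ d, 0 < d → d < 2 * L → X d < X 0 := fun d h0 h1 => by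
    rcases lt_trichotomy d L with h2 | rfl | h2
    · exact (abs_lt.1 (abs_lt_of_strictMaximal h hw h0 h2)).2
    · have := hX 0; rw [zero_add] at this; omega
    · have h3 := (abs_lt.1 (abs_lt_of_strictMaximal h hw (i := d - L) (by omega) (by omega))).1
      have h4 := hX (d - L)
      rw [Nat.sub_add_cancel h2.le] at h4
      omega
  have hinj : Set.InjOn y (Finset.range (2 * L) : Set ℕ) := by
    have key : ∀ i j, i < j → j < 2 * L → y i ≠ y j := fun i j hij hj he => by
      have h1 : y (i + (2 * L - i)) = y (j + (2 * L - i)) := by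
        simp only [hy, pow_add, ← mul_assoc] at he ⊢
        rw [he]
      rw [show i + (2 * L - i) = 0 + 2 * L by omega,
        show j + (2 * L - i) = (j - i) + 2 * L by omega, hper, hper, hyX] at h1
      have := hne (j - i) (by omega) (by omega)
      omega
    intro i hi j hj he
    rw [Finset.coe_range, Set.mem_Iio] at hi hj
    rcases lt_trichotomy i j with h1 | h1 | h1
    · exact absurd he (key i j h1 hj)
    · exact h1
    · exact absurd he.symm (key j i h1 hi)
  have himg : cyclotomicCoset q n s = y '' (Finset.range (2 * L) : Set ℕ) := by
    ext x
    constructor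
    · rintro ⟨j, rfl⟩
      refine ⟨j % (2 * L), by simpa using Nat.mod_lt _ (by omega), ?_⟩
      have := hperk (j / (2 * L)) (j % (2 * L))
      rw [mul_comm (j / (2 * L)), Nat.mod_add_div] at this
      exact this.symm
    · rintro ⟨j, -, rfl⟩
      exact ⟨j, rfl⟩
  rw [himg, hinj.ncard_image, Set.ncard_coe_finset, Finset.card_range]

end Cosets

/-! ### Values of the extremal words -/

section ExtremalValues

variable {q n : ℤ} {X : ℕ → ℤ}

lemma value_blocks₂ (h : IsExpansion q n X (blockWord fun _ => false)) (hX : X 4 = -X 0) : X 0 * (q ^ 4 + 1) = n * (q ^ 3 - q + 1) := by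
  have h1 := deviation_succ h 0
  simp only [Bool.false_eq_true, if_false] at h1
  simp [deviation, blockSign_succ, hX] at h1
  have : (q ^ 4 + 1) * (X 0 * (q ^ 4 + 1) - n * (q ^ 3 - q + 1)) = 0 := by linarith
  have := (mul_eq_zero.1 this).resolve_left (by positivity)
  linarith

/-- After M blocks the deviation returns to its initial value. This is a linear equation for it,
with coefficient 1 + q^(4M) = n, which cancels. -/
lemma value_blocks₃ {M : ℕ} (hM : 3 ≤ M) (hodd : Odd M) (hn : n = q ^ (4 * M) + 1)
    (h : IsExpansion q n X (blockWord (blocks₃ M))) (hX : X (4 * M) = -X 0) :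
    X 0 * (q ^ 4 + 1) =
      n * (q ^ 3 - q + 1) + (q - 1) ^ 2 * (q ^ 2 - 1) * (1 + q ^ (4 * M - 8)) := by
  have hM4 : ∀ i, i < M → (blocks₃ M i = decide (i = 1 ∨ i = M - 1)) := fun i hi => by
    simp [blocks₃, Nat.mod_eq_of_lt hi]
  have h1 := deviation_succ h 0
  have h2 := deviation_succ h 1
  have h3 := deviation_run h (a := 2) (k := M - 3)
    (by obtain ⟨k, rfl⟩ := hodd; exact ⟨k - 1, by omega⟩)
    fun j h1 h2 => by rw [hM4 _ (by omega)]; simp; omega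
  have h4 := deviation_succ h (M - 1)
  rw [hM4 _ (by omega), if_neg (by simp; omega), zero_add] at h1
  rw [hM4 _ (by omega), if_pos (by simp)] at h2
  rw [hM4 _ (by omega), if_pos (by simp), show M - 1 + 1 = M by omega] at h4
  rw [show 2 + (M - 3) = M - 1 by omega] at h3
  have h5 : deviation q n X (blocks₃ M) M = deviation q n X (blocks₃ M) 0 := by
    simp [deviation, blockSign_blocks₃ hM hodd, hX]
  rw [h3, h2, h1, h5] at h4
  simp only [deviation, blockSign_zero, mul_zero] at h4
  have hn0 := h.pos
  obtain ⟨k, rfl⟩ : ∃ k, M = k + 3 := ⟨M - 3, by omega⟩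
  rw [show 4 * (k + 3) - 8 = 4 * k + 4 by omega]
  rw [show k + 3 - 3 = k by omega] at h4
  rw [show 4 * (k + 3) = 4 * k + 12 by omega] at hn
  refine sub_eq_zero.1 ((mul_eq_zero.1 ?_).resolve_left hn0.ne')
  rw [pow_add] at hn ⊢
  generalize q ^ (4 * k) = Q at *
  linear_combination h4 + (X 0 * (q ^ 4 + 1) - n * (q ^ 3 - q + 1)) * hn

lemma value_blocks₄ {M : ℕ} (hM : 5 ≤ M) (hodd : Odd M) (hn : n = q ^ (4 * M) + 1)
    (h : IsExpansion q n X (blockWord (blocks₄ M))) (hX : X (4 * M) = -X 0) :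
    X 0 * (q ^ 4 + 1) =
      n * (q ^ 3 - q + 1) + (q - 1) ^ 2 * (q ^ 2 - 1) * (q ^ 8 + q ^ (4 * M - 8)) := by
  have hM4 : ∀ i, i < M → (blocks₄ M i = decide (i = 1 ∨ i = M - 3)) := fun i hi => by
    simp [blocks₄, Nat.mod_eq_of_lt hi]
  have h1 := deviation_succ h 0
  have h2 := deviation_succ h 1
  have h3 := deviation_run h (a := 2) (k := M - 5)
    (by obtain ⟨k, rfl⟩ := hodd; exact ⟨k - 2, by omega⟩)
    fun j h1 h2 => by rw [hM4 _ (by omega)]; simp; omega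
  have h4 := deviation_succ h (M - 3)
  have h6 := deviation_run h (a := M - 2) (k := 2) (by decide)
    fun j h1 h2 => by rw [hM4 _ (by omega)]; simp; omega
  rw [hM4 _ (by omega), if_neg (by simp; omega), zero_add] at h1
  rw [hM4 _ (by omega), if_pos (by simp)] at h2
  rw [hM4 _ (by omega), if_pos (by simp), show M - 3 + 1 = M - 2 by omega] at h4
  rw [show 2 + (M - 5) = M - 3 by omega] at h3
  rw [show M - 2 + 2 = M by omega] at h6
  have h5 : deviation q n X (blocks₄ M) M = deviation q n X (blocks₄ M) 0 := by
    simp [deviation, blockSign_blocks₄ hM hodd, hX]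
  rw [h4, h3, h2, h1, h5] at h6
  simp only [deviation, blockSign_zero, mul_zero] at h6
  have hn0 := h.pos
  obtain ⟨k, rfl⟩ : ∃ k, M = k + 5 := ⟨M - 5, by omega⟩
  rw [show 4 * (k + 5) - 8 = 4 * k + 12 by omega]
  rw [show k + 5 - 5 = k by omega] at h6
  rw [show 4 * (k + 5) = 4 * k + 20 by omega] at hn
  refine sub_eq_zero.1 ((mul_eq_zero.1 ?_).resolve_left hn0.ne')
  rw [pow_add] at hn ⊢
  generalize q ^ (4 * k) = Q at *
  linear_combination h6 + (X 0 * (q ^ 4 + 1) - n * (q ^ 3 - q + 1)) * hn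

/-- The fourth word in length `12`. -/
def word₁₂ (k : ℕ) : ℤ :=
  (-1) ^ (k / 12) * ![1, 0, -1, 1, -1, 1, -1, 0, 1, -1, 1, 0] (Fin.ofNat 12 k)

lemma word₁₂_add (k : ℕ) : word₁₂ (k + 12) = -word₁₂ k := by
  have : Fin.ofNat 12 (k + 12) = Fin.ofNat 12 k := by ext; simp
  unfold word₁₂
  rw [this, show (k + 12) / 12 = k / 12 + 1 by omega, pow_succ]
  ring

lemma abs_word₁₂_le (k : ℕ) : |word₁₂ k| ≤ 1 := by
  have : ∀ x : Fin 12, |(![1, 0, -1, 1, -1, 1, -1, 0, 1, -1, 1, 0] x : ℤ)| ≤ 1 := by decide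
  unfold word₁₂
  rw [abs_mul, abs_pow, abs_neg, abs_one, one_pow, one_mul]
  exact this _

lemma strictMaximal_word₁₂ : StrictMaximal 12 word₁₂ := by
  have key : ∀ i < 12, 0 < i → ∀ ε ∈ ([1, -1] : List ℤ), ∃ k < 12,
      (∀ j < k, ε * word₁₂ (i + j) = word₁₂ j) ∧ ε * word₁₂ (i + k) < word₁₂ k := by
    decide
  intro i h0 hi ε hε
  obtain ⟨k, -, hk⟩ := key i hi h0 ε (by simpa using hε)
  exact ⟨k, hk⟩

lemma value_word₁₂ : wordValue q 12 word₁₂ 0 =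
    q ^ 11 - q ^ 9 + q ^ 8 - q ^ 7 + q ^ 6 - q ^ 5 + q ^ 3 - q ^ 2 + q := by
  have : ∀ k, k ∈ Finset.range 12 → word₁₂ (0 + k) * q ^ (12 - 1 - k) =
    (![1, 0, -1, 1, -1, 1, -1, 0, 1, -1, 1, 0] (Fin.ofNat 12 k) : ℤ) * q ^ (11 - k) := by
    intro k hk
    have hk := Finset.mem_range.1 hk
    simp [word₁₂, Nat.div_eq_of_lt hk]
  rw [wordValue, Finset.sum_congr rfl this]
  simp [Finset.sum_range_succ, Fin.ofNat]
  ring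

end ExtremalValues

/-! ### Words all of whose signed shifts are bounded -/

/-- No signed shift of `a` exceeds `w` lexicographically. -/
def ShiftsLE (a w : ℕ → ℤ) : Prop :=
  ∀ i : ℕ, ∀ ε : ℤ, ε = 1 ∨ ε = -1 → ∀ k, (∀ j < k, ε * a (i + j) = w j) → ε * a (i + k) ≤ w k

/-- The local restrictions common to the words considered. -/
structure LocalRules (a : ℕ → ℤ) : Prop where
  le : ∀ i, a i ≤ 1
  ge : ∀ i, -1 ≤ a i
  one : ∀ i, a i = 1 → a (i + 1) ≤ 0
  one' : ∀ i, a i = -1 → 0 ≤ a (i + 1)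
  two : ∀ i, a i = 1 → a (i + 1) = 0 → a (i + 2) = -1
  two' : ∀ i, a i = -1 → a (i + 1) = 0 → a (i + 2) = 1
  four : ∀ i, a i = 1 → a (i + 1) = 0 → a (i + 2) = -1 → a (i + 3) = 1 → a (i + 4) = -1
  four' : ∀ i, a i = -1 → a (i + 1) = 0 → a (i + 2) = 1 → a (i + 3) = -1 → a (i + 4) = 1

section

variable {a w : ℕ → ℤ}

lemma ShiftsLE.pos (h : ShiftsLE a w) (i k : ℕ) (hk : ∀ j < k, a (i + j) = w j) :
    a (i + k) ≤ w k := by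
  simpa using h i 1 (by simp) k (by simpa using hk)

lemma ShiftsLE.neg (h : ShiftsLE a w) (i k : ℕ) (hk : ∀ j < k, -a (i + j) = w j) :
    -a (i + k) ≤ w k := by
  simpa using h i (-1) (by simp) k (by simpa using hk)

lemma ShiftsLE.not_lexLT (h : ShiftsLE a w) (i : ℕ) {ε : ℤ} (hε : ε = 1 ∨ ε = -1) :
    ¬ LexLT w fun k => ε * a (i + k) := by
  rintro ⟨k, h1, h2⟩
  exact absurd (h i ε hε k fun j hj => (h1 j hj).symm) (not_le.2 h2)

/-- Each rule bounds the next digit of a signed shift that has followed the beginning 1, 0, -1, 1,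
-1 of w so far. -/
lemma ShiftsLE.localRules (h : ShiftsLE a w) (w0 : w 0 = 1) (w1 : w 1 = 0) (w2 : w 2 = -1)
    (w3 : w 3 = 1) (w4 : w 4 = -1) : LocalRules a := by
  have le : ∀ i, a i ≤ 1 := fun i => by simpa [w0] using h.pos i 0 (by simp)
  have ge : ∀ i, -1 ≤ a i := fun i => by have := h.neg i 0 (by simp); simp [w0] at this; omega
  refine ⟨le, ge, fun i h0 => ?_, fun i h0 => ?_, fun i h0 h1 => ?_, fun i h0 h1 => ?_,
    fun i h0 h1 h2 h3 => ?_, fun i h0 h1 h2 h3 => ?_⟩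
  · have := h.pos i 1 fun j hj => by interval_cases j; simp [h0, w0]
    omega
  · have := h.neg i 1 fun j hj => by interval_cases j; simp [h0, w0]
    omega
  · have := h.pos i 2 fun j hj => by interval_cases j <;> simp [h0, w0, h1, w1]
    have := ge (i + 2)
    omega
  · have := h.neg i 2 fun j hj => by interval_cases j <;> simp [h0, w0, h1, w1]
    have := le (i + 2)
    omega
  · have := h.pos i 4 fun j hj => by interval_cases j <;> simp [h0, w0, h1, w1, h2, w2, h3, w3]
    have := ge (i + 4)
    omega
  · have := h.neg i 4 fun j hj => by interval_cases j <;> simp [h0, w0, h1, w1, h2, w2, h3, w3]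
    have := le (i + 4)
    omega

/-- By maximality, a beginning 1, -1 forces the word 1, -1, 1, -1, ... and a beginning 1, 0, -1, 0
forces 1, 0, -1, 0, ... repeated. Both are periodic with a period dividing 4M, against a (4M) = -a
0. -/
lemma prefix_of_shiftsLE (hr : LocalRules a) (hmax : ShiftsLE a a) (h0 : ∃ i, a i ≠ 0) {M : ℕ}
    (ha : ∀ j, a (j + 4 * M) = -a j) : a 0 = 1 ∧ a 1 = 0 ∧ a 2 = -1 ∧ a 3 = 1 := by
  have a0 : a 0 = 1 := by
    obtain ⟨i, hi⟩ := h0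
    have h1 := hmax.pos i 0 (by simp)
    have h2 := hmax.neg i 0 (by simp)
    have := hr.le 0
    simp only [add_zero] at h1 h2
    omega
  have hM := ha 0
  have a1 : a 1 = 0 := by
    by_contra h1
    have h1 : a 1 = -1 := by have : a 1 ≤ 0 := hr.one 0 a0; have := hr.ge 1; omega
    have key : ∀ k, a (2 * k) = 1 := fun k => by
      induction k with
      | zero => exact a0
      | succ k ih =>
        have h2 := hmax.pos (2 * k) 1 fun j hj => by interval_cases j; simp [ih, a0]
        have h3 : a (2 * k + 1) = -1 := by have := hr.ge (2 * k + 1); omega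
        have h4 := hmax.neg (2 * k + 1) 1 fun j hj => by interval_cases j; simp [h3, a0]
        have := hr.le (2 * k + 1 + 1)
        rw [show 2 * (k + 1) = 2 * k + 1 + 1 by ring]
        omega
    have := key (2 * M)
    rw [zero_add, a0] at hM
    rw [← mul_assoc, show 2 * 2 * M = 4 * M by ring, hM] at this
    omega
  have a2 : a 2 = -1 := hr.two 0 a0 a1
  refine ⟨a0, a1, a2, ?_⟩
  by_contra h3
  have a3 : a 3 = 0 := by have := hr.le 3; have : 0 ≤ a 3 := hr.one' 2 a2; omega
  have key : ∀ k, a (4 * k) = 1 ∧ a (4 * k + 1) = 0 := fun k => by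
    induction k with
    | zero => exact ⟨a0, a1⟩
    | succ k ih =>
      obtain ⟨b0, b1⟩ := ih
      have b2 := hr.two _ b0 b1
      have b3 : a (4 * k + 3) = 0 := by
        have := hmax.pos (4 * k) 3 fun j hj => by
          interval_cases j <;> simp [a0, a1, a2, b0, b1, b2]
        have : 0 ≤ a (4 * k + 3) := hr.one' _ b2
        omega
      have b4 := hr.two' _ b2 b3
      have b5 : a (4 * k + 5) = 0 := by
        have := hmax.neg (4 * k + 2) 3 fun j hj => by
          interval_cases j <;> simp [a0, a1, a2, b2, b3, b4]
        simp only [add_assoc, Nat.reduceAdd] at this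
        have : a (4 * k + 5) ≤ 0 := hr.one _ b4
        omega
      exact ⟨b4, b5⟩
  have := (key M).1
  rw [zero_add] at hM
  omega

lemma eq_of_antiperiodic {m : ℕ} (hm : 0 < m) {b : ℕ → ℤ} (ha : ∀ j, a (j + m) = -a j)
    (hb : ∀ j, b (j + m) = -b j) (h : ∀ j < m, a j = b j) (j : ℕ) : a j = b j := by
  induction j using Nat.strong_induction_on with
  | _ j ih =>
    rcases lt_or_ge j m with h1 | h1
    · exact h j h1
    · obtain ⟨k, rfl⟩ := Nat.exists_eq_add_of_le' h1
      rw [ha, hb, ih k (by omega)]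

/-- The digits are forced one at a time, with a 12 = -1 closing the word. If a 5 = 0, maximality
leaves the two block words; if a 5 = 1, the word is already as large as `word₁₂` there, and the
upper bound fixes the rest. -/
lemma classification₁₂ (hmax : ShiftsLE a a) (hw : ShiftsLE a word₁₂)
    (ha : ∀ j, a (j + 12) = -a j) (h0 : ∃ i, a i ≠ 0) :
    (∀ j, a j = blockWord (fun _ => false) j) ∨ (∀ j, a j = blockWord (blocks₃ 3) j) ∨
      ∀ j, a j = word₁₂ j := by
  have hr := hw.localRules (by decide) (by decide) (by decide) (by decide) (by decide)
  obtain ⟨a0, a1, a2, a3⟩ := prefix_of_shiftsLE hr hmax h0 (M := 3) ha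
  have a4 := hr.four 0 a0 a1 a2 a3
  have a12 := ha 0
  rw [a0, zero_add] at a12
  have a11' : a 11 ≠ -1 := fun h => by have : 0 ≤ a 12 := hr.one' 11 h; omega
  have ext : ∀ b : ℕ → ℤ, (∀ j, b (j + 12) = -b j) → (∀ j < 12, a j = b j) → ∀ j, a j = b j :=
    fun b hb h => eq_of_antiperiodic (by norm_num) ha hb h
  have w : ∀ j < 12, word₁₂ j = ![1, 0, -1, 1, -1, 1, -1, 0, 1, -1, 1, 0] (Fin.ofNat 12 j) := by
    decide
  have a5 : a 5 = 0 ∨ a 5 = 1 := by have := hr.one' 4 a4; have := hr.le 5; simp at *; omega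
  rcases a5 with a5 | a5
  · have a6 := hr.two' 4 a4 a5
    have r5 : ∀ i, a i = 1 → a (i + 1) = 0 → a (i + 2) = -1 → a (i + 3) = 1 → a (i + 5) ≤ 0 :=
      fun i h0 h1 h2 h3 => by
        have h4 := hr.four i h0 h1 h2 h3
        have := hmax.pos i 5 fun j hj => by interval_cases j <;> simp [*]
        omega
    have a7 : a 7 = 0 ∨ a 7 = -1 := by have := hr.one 6 a6; have := hr.ge 7; simp at *; omega
    rcases a7 with a7 | a7
    · have a8 := hr.two 6 a6 a7
      have a9 : a 9 = 0 := by
        by_contra h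
        have a9 : a 9 = 1 := by
          have := hr.one' 8 a8; have := hr.le 9; simp at *; omega
        have a10 := hr.four 6 a6 a7 a8 a9
        have a11 := r5 6 a6 a7 a8 a9
        have := hr.ge 11
        have a11 : a 11 = 0 := by simp at *; omega
        have := hr.two' 10 a10 a11
        simp at *; omega
      have a10 := hr.two' 8 a8 a9
      have a11 : a 11 = 0 := by have := hr.one 10 a10; have := hr.ge 11; simp at *; omega
      right; left
      refine ext _ (blockWord_add_period (M := 3) (blocks₃_add 3) (by decide)) ?_
      have : ∀ j < 12, blockWord (blocks₃ 3) j =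
          ![1, 0, -1, 1, -1, 0, 1, 0, -1, 0, 1, 0] (Fin.ofNat 12 j) := by decide
      intro j hj
      rw [this j hj]
      simp only [Nat.reduceAdd] at *
      interval_cases j <;> simp [*, Fin.ofNat]
    · have a8 := hr.four' 4 a4 a5 a6 a7
      have a9 : a 9 = 0 := by
        have h1 := hmax.neg 4 5 fun j hj => by interval_cases j <;> simp [*]
        have := hr.one 8 a8
        simp at *; omega
      have a10 := hr.two 8 a8 a9
      have a11 : a 11 = 1 := by
        by_contra h
        have a11 : a 11 = 0 := by have := hr.one' 10 a10; have := hr.le 11; simp at *; omega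
        have := hr.two' 10 a10 a11
        simp at *; omega
      left
      refine ext _ (blockWord_add_period (M := 3) (fun _ => rfl) (by decide)) ?_
      have : ∀ j < 12, blockWord (fun _ => false) j =
          ![1, 0, -1, 1, -1, 0, 1, -1, 1, 0, -1, 1] (Fin.ofNat 12 j) := by decide
      intro j hj
      rw [this j hj]
      simp only [Nat.reduceAdd] at *
      interval_cases j <;> simp [*, Fin.ofNat]
  · have a6 : a 6 = -1 := by
      have h1 := hw.pos 0 6 fun j hj => by
        interval_cases j <;> simp [*, Fin.ofNat]
      have := hr.ge 6
      simp [w, Fin.ofNat] at h1; omega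
    have a7 : a 7 = 0 := by
      have h1 := hw.pos 0 7 fun j hj => by
        interval_cases j <;> simp [*, Fin.ofNat]
      have := hr.one' 6 a6
      simp [w, Fin.ofNat] at *; omega
    have a8 := hr.two' 6 a6 a7
    have a9 : a 9 = -1 := by
      have h1 := hw.pos 0 9 fun j hj => by
        interval_cases j <;> simp [*, Fin.ofNat]
      have := hr.ge 9
      simp [w, Fin.ofNat] at *; omega
    have a10 := hr.four' 6 a6 a7 a8 a9
    have a11 : a 11 = 0 := by have := hr.one 10 a10; have := hr.ge 11; simp at *; omega
    right; right
    refine ext _ word₁₂_add fun j hj => ?_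
    rw [w j hj]
    simp only [Nat.reduceAdd] at *
    interval_cases j <;> simp [*, Fin.ofNat]

end

/-! ### Parsing into blocks -/

section Parse

variable {a : ℕ → ℤ}

/-- The `j`-th block read off from `a`. -/
def readBlock (a : ℕ → ℤ) (j : ℕ) : Bool := decide (a (4 * j + 3) = 0)

/-- Induction on blocks: from its last non-zero block on, the word agrees up to sign with the
beginning of the bound d, so the bound dictates the next block up to its last digit. As d has just H
zero blocks before its next non-zero one, runs of zero blocks have length at most H. -/
lemma parse_blocks {d : ℕ → Bool} {H : ℕ} (hr : LocalRules a) (hw : ShiftsLE a (blockWord d))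
    (hd0 : d 0 = false) (hd1 : ∀ j, 1 ≤ j → j ≤ H → d j = true) (hd2 : d (H + 1) = false)
    (h0 : a 0 = 1) (h1 : a 1 = 0) (h2 : a 2 = -1) (h3 : a 3 = 1) (j : ℕ) :
    (∀ k < 4 * (j + 1), a k = blockWord (readBlock a) k) ∧
      ∃ h ≤ H, h ≤ j ∧ readBlock a (j - h) = false ∧
        ∀ i, j - h < i → i ≤ j → readBlock a i = true := by
  set c := readBlock a with hc
  induction j with
  | zero =>
    have c0 : c 0 = false := by simp [hc, readBlock, h3]
    refine ⟨fun k hk => ?_, 0, by omega, by omega, c0, fun i h1 h2 => by omega⟩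
    rw [zero_add, mul_one] at hk
    have := blockWord_mul_add c 0 hk
    rw [mul_zero, zero_add] at this
    rw [this, c0]
    interval_cases k <;> simp [block, *]
  | succ j ih =>
    obtain ⟨hk, h, hH, hj, hp, hrun⟩ := ih
    obtain ⟨p, rfl⟩ := Nat.exists_eq_add_of_le' hj
    rw [Nat.add_sub_cancel] at hp hrun
    have hcd : ∀ i ≤ h, c (p + i) = d i := fun i hi => by
      rcases Nat.eq_zero_or_pos i with rfl | h0
      · rw [hd0]; exact hp
      · rw [hrun _ (by omega) (by omega), hd1 i h0 (by omega)]
    have hsd : blockSign d (h + 1) = blockSign (fun i => c (p + i)) (h + 1) :=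
      blockSign_congr fun i hi => (hcd i (by omega)).symm
    have hsd1 : blockSign d (h + 1) = -1 := by
      clear hsd hcd hrun hk hj
      induction h with
      | zero => simp [blockSign_succ, hd0]
      | succ h ih => rw [blockSign_succ_of_true (hd1 _ (by omega) (by omega)), ih (by omega)]
    have hs : blockSign c (p + h + 1) = -blockSign c p := by
      rw [add_assoc, blockSign_add, ← hsd, hsd1]; ring
    have hagree : ∀ k < 4 * (h + 1), blockSign c p * a (4 * p + k) = blockWord d k :=
      fun k hk' => by
        rw [hk _ (by omega), blockWord_shift, ← mul_assoc, blockSign_mul_self, one_mul]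
        exact blockWord_congr fun i hi => hcd i (by omega)
    -- The block of d compared with here has sign -1: only one sign change, that of block 0,
    -- precedes it.
    have hnext : ∀ r < 4, (∀ r' < r, blockSign c p * a (4 * (p + h + 1) + r') =
        -block (d (h + 1)) r') →
        blockSign c p * a (4 * (p + h + 1) + r) ≤ -block (d (h + 1)) r := fun r hr h' => by
      have := hw (4 * p) _ (blockSign_eq_or c p) (4 * (h + 1) + r) fun k hk' => by
        rcases lt_or_ge k (4 * (h + 1)) with h1 | h1
        · exact hagree k h1
        · obtain ⟨r', rfl⟩ := Nat.exists_eq_add_of_le h1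
          rw [blockWord_mul_add _ _ (by omega), hsd1, neg_one_mul, ← h' r' (by omega)]
          congr 2; ring
      rw [blockWord_mul_add _ _ hr, hsd1, neg_one_mul] at this
      convert this using 3; ring
    have n0 := hnext 0 (by omega) (by omega)
    have hs1 := blockSign_eq_or c p
    set ε := blockSign c p with hε
    set b := 4 * (p + h + 1) with hb
    have e0 : a (b + 0) = -ε := by
      have := hr.le b; have := hr.ge b
      simp [block] at n0
      rcases hs1 with h | h <;> rw [h] at n0 ⊢ <;> simp at * <;> omega
    have e0' : a b = -ε := e0
    have hee : ε * ε = 1 := blockSign_mul_self c p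
    have n1 := hnext 1 (by omega) fun r hr => by
      interval_cases r; rw [e0]; simp [block, hee]
    have e1 : a (b + 1) = 0 := by
      simp [block] at n1
      rcases hs1 with h | h <;> rw [h] at n1 e0 <;> simp at n1 e0
      · have := hr.one' _ e0; omega
      · have := hr.one _ e0; omega
    have e2 : a (b + 2) = ε := by
      rcases hs1 with h | h <;> rw [h] at e0 ⊢ <;> simp at e0
      · exact hr.two' _ e0 e1
      · exact hr.two _ e0 e1
    have n3 := hnext 3 (by omega) fun r hr => by
      interval_cases r <;> simp [block, e0', e1, e2, hee]
    have e3 : a (b + 3) = 0 ∨ a (b + 3) = -ε := by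
      have := hr.le (b + 3); have := hr.ge (b + 3)
      rcases hs1 with h | h <;> rw [h] at e2 ⊢
      · have : a (b + 3) ≤ 0 := hr.one _ e2
        omega
      · have : 0 ≤ a (b + 3) := hr.one' _ e2
        omega
    have hε0 : ε ≠ 0 := by rintro h; simp [h] at hee
    have hcj : c (p + h + 1) = decide (a (b + 3) = 0) := rfl
    refine ⟨fun k hk' => ?_, ?_⟩
    · rcases lt_or_ge k b with h1 | h1
      · exact hk k (by omega)
      · obtain ⟨r, rfl⟩ := Nat.exists_eq_add_of_le h1
        have hr4 : r < 4 := by omega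
        rw [blockWord_mul_add _ _ hr4, hs]
        interval_cases r
        · simpa [block] using e0
        · simpa [block] using e1
        · simpa [block] using e2
        · rcases e3 with e3 | e3 <;> simp [block, hcj, e3, hε0]
    · rcases Bool.eq_false_or_eq_true (c (p + h + 1)) with ht | ht
      · refine ⟨h + 1, ?_, by omega, ?_, fun i h1 h2 => ?_⟩
        -- After H zero blocks the bound has a block ending in -1, so a last digit 0 would exceed
        -- it.
        · by_contra hlt
          obtain rfl : h = H := by omega
          rw [hcj, decide_eq_true_eq] at ht
          simp [block, hd2, ht] at n3
        · rw [show p + h + 1 - (h + 1) = p by omega]; exact hp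
        · rcases Nat.lt_or_ge i (p + h + 1) with h3 | h3
          · exact hrun i (by omega) (by omega)
          · rw [show i = p + h + 1 by omega]; exact ht
      · exact ⟨0, by omega, by omega, ht, fun i h1 h2 => by omega⟩

end Parse

/-! ### Classification of the block sequences -/

lemma eq_of_periodic {M : ℕ} (hM : 0 < M) {b b' : ℕ → Bool} (hb : ∀ j, b (j + M) = b j)
    (hb' : ∀ j, b' (j + M) = b' j) (h : ∀ j < M, b j = b' j) (j : ℕ) : b j = b' j := by
  induction j using Nat.strong_induction_on with
  | _ j ih =>
    rcases lt_or_ge j M with h1 | h1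
    · exact h j h1
    · obtain ⟨k, rfl⟩ := Nat.exists_eq_add_of_le' h1
      rw [hb, hb', ih k (by omega)]

/-- A sequence of odd period that is somewhere `true` has consecutive `true` entries at an odd
distance. -/
lemma exists_odd_gap {c : ℕ → Bool} {M p : ℕ} (hodd : Odd M) (hc : ∀ j, c (j + M) = c j)
    (hp : c p = true) : ∃ r D, p ≤ r ∧ Odd D ∧ D ≤ M ∧ c r = true ∧ c (r + D) = true ∧
      ∀ j, 0 < j → j < D → c (r + j) = false := by
  -- Take the first odd offset k with a `true` entry (M is one) and the last `true` entry before it.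
  -- That one has even offset by minimality, so the gap is odd.
  have hex : ∃ k, Odd k ∧ c (p + k) = true := ⟨M, hodd, by rw [hc, hp]⟩
  classical
  set k := Nat.find hex with hk
  obtain ⟨hk1, hk2⟩ := Nat.find_spec hex
  have hkM : k ≤ M := Nat.find_min' hex ⟨hodd, by rw [hc, hp]⟩
  have hmin : ∀ j, j < k → Odd j → c (p + j) = false := fun j h1 h2 => by
    have := Nat.find_min hex h1
    simpa [h2] using this
  have hkpos : 0 < k := hk1.pos
  obtain ⟨l, hl1, hl2, hl3, hl4⟩ : ∃ l, l < k ∧ Even l ∧ c (p + l) = true ∧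
      ∀ j, l < j → j < k → c (p + j) = false := by
    have hne : ((Finset.range k).filter fun l => c (p + l) = true).Nonempty :=
      ⟨0, by simp [hkpos, hp]⟩
    set l := Finset.max' _ hne with hl
    have hmem := Finset.max'_mem _ hne
    rw [← hl, Finset.mem_filter, Finset.mem_range] at hmem
    refine ⟨l, hmem.1, ?_, hmem.2, fun j h1 h2 => ?_⟩
    · by_contra h
      have := hmin l hmem.1 (Nat.not_even_iff_odd.1 h)
      rw [hmem.2] at this
      simp at this
    · by_contra h
      have : j ≤ l := Finset.le_max' _ j (by simp [h2, h])
      omega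
  refine ⟨p + l, k - l, by omega, Nat.Odd.sub_even hl1.le hk1 hl2, by omega, hl3, ?_,
    fun j h1 h2 => ?_⟩
  · rw [show p + l + (k - l) = p + k by omega]; exact hk2
  · rw [add_assoc]; exact hl4 _ (by omega) (by omega)

lemma blocks_classification {c : ℕ → Bool} {M : ℕ} (hM : 7 ≤ M) (hodd : Odd M)
    (hc : ∀ j, c (j + M) = c j) (h0 : c 0 = false)
    (hadj : ∀ j, c (j + 1) = true → c j = false) (hs : blockSign c M = -1)
    (hlex : ∀ p, ¬ LexLT (blockWord (blocks₄ M)) (blockWord fun i => c (p + i))) :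
    (∀ j, c j = false) ∨ ∃ p, (∀ j, c (p + j) = blocks₃ M j) ∨ ∀ j, c (p + j) = blocks₄ M j := by
  by_cases hall : ∀ j, c j = false
  · exact Or.inl hall
  push Not at hall
  obtain ⟨p', hp'⟩ := hall
  rw [ne_eq, Bool.not_eq_false] at hp'
  obtain ⟨r, D, hr, hD, hDM, hcr, hcD, hgap⟩ := exists_odd_gap hodd hc hp'
  have hr0 : 0 < r := by
    rcases Nat.eq_zero_or_pos r with rfl | h
    · rw [h0] at hcr; simp at hcr
    · exact h
  obtain ⟨p, rfl⟩ : ∃ p, r = p + 1 := ⟨r - 1, by omega⟩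
  set b : ℕ → Bool := fun i => c (p + i) with hb
  have b0 : b 0 = false := hadj _ hcr
  have b1 : b 1 = true := hcr
  have bD : b (1 + D) = true := by simpa only [hb, add_assoc] using hcD
  have bgap : ∀ j, 2 ≤ j → j < 1 + D → b j = false := fun j h1 h2 => by
    have := hgap (j - 1) (by omega) (by omega)
    rw [show p + 1 + (j - 1) = p + j by omega] at this
    exact this
  have bper : ∀ j, b (j + M) = b j := fun j => by simp only [hb, ← add_assoc]; exact hc _
  have badj : ∀ j, b (j + 1) = true → b j = false := fun j h => hadj _ h
  have bs : blockSign b M = -1 := by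
    have h1 := blockSign_add c p M
    have h2 := blockSign_add c M p
    rw [add_comm p M, h2, hs] at h1
    simp only [add_comm M, hc] at h1
    rcases blockSign_eq_or c p with h | h <;> rw [h] at h1 <;> linarith
  have hM4 : ∀ i, i < M → (blocks₄ M i = decide (i = 1 ∨ i = M - 3)) := fun i hi => by
    simp [blocks₄, Nat.mod_eq_of_lt hi]
  have hM3 : ∀ i, i < M → (blocks₃ M i = decide (i = 1 ∨ i = M - 1)) := fun i hi => by
    simp [blocks₃, Nat.mod_eq_of_lt hi]
  -- For a smaller D the shift has its zero block earlier than `blocks₄ M`. As D is odd, the sign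
  -- there is negative and the zero block is larger, so the shift would exceed the bound.
  have hDge : M - 4 ≤ D := by
    by_contra hlt
    refine hlex p (blockWord_lexLT (J := 1 + D) (fun j hj => ?_) ?_ ?_)
    · rw [hM4 j (by omega)]
      change _ = b j
      rcases Nat.lt_or_ge j 2 with h | h
      · interval_cases j
        · rw [b0]; simp; omega
        · rw [b1]; simp
      · rw [bgap j h hj]; simp; omega
    · change _ ≠ b _
      rw [bD, hM4 _ (by omega)]; simp; have := hD.pos; omega
    · have : blocks₄ M (1 + D) = false := by
        rw [hM4 _ (by omega)]; simp; have := hD.pos; omega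
      rw [this]
      have h2 : blockSign (blocks₄ M) 2 = -1 := by
        apply blockSign_two <;> rw [hM4 _ (by omega)] <;> simp; omega
      have h3 := blockSign_of_run (c := blocks₄ M) (a := 2) (k := D - 1) fun j h1 h2 => by
        rw [hM4 _ (by omega)]; simp; omega
      rw [show 2 + (D - 1) = 1 + D by have := hD.pos; omega, h2, Even.neg_one_pow] at h3
      · rw [h3]; simp
      · obtain ⟨k, rfl⟩ := hD; exact ⟨k, by omega⟩
  have hb2 : blockSign b 2 = -1 := blockSign_two b0 b1
  have hrun : ∀ k, k + 1 ≤ D → blockSign b (2 + k) = -(-1) ^ k := fun k hk => by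
    rw [blockSign_of_run fun j h1 h2 => bgap j h1 (by omega), hb2]; ring
  right
  obtain rfl | rfl | rfl : D = M ∨ D = M - 2 ∨ D = M - 4 := by
    obtain ⟨k, hk⟩ := hD; obtain ⟨l, hl⟩ := hodd; omega
  -- A single zero block leaves M - 1 sign changes, an even number, against the sign -1 over a
  -- period.
  · have := hrun (D - 2) (by omega)
    rw [show 2 + (D - 2) = D by omega, bs, Odd.neg_one_pow] at this
    · norm_num at this
    · obtain ⟨k, rfl⟩ := hodd; exact ⟨k - 1, by omega⟩
  · refine ⟨p, Or.inl (eq_of_periodic (b := b) (by omega) bper (blocks₃_add M) fun j hj => ?_)⟩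
    rw [hM3 j hj]
    rcases Nat.lt_or_ge j 2 with h | h
    · interval_cases j
      · rw [b0]; simp; omega
      · rw [b1]; simp
    · rcases Nat.lt_or_ge j (M - 1) with h' | h'
      · rw [bgap j h (by omega)]; simp; omega
      · obtain rfl : j = 1 + (M - 2) := by omega
        rw [bD]; simp; omega
  · have b2 : b (M - 3) = true := by rw [← bD]; congr 1; omega
    have b3 : b (M - 2) = false := by
      by_contra h
      rw [Bool.not_eq_false, show M - 2 = M - 3 + 1 by omega] at h
      have := badj _ h
      rw [b2] at this
      simp at this
    have b4 : b (M - 1) = false := by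
      by_contra h
      rw [Bool.not_eq_false] at h
      -- A third zero block, at M - 1, would likewise make the number of sign changes even.
      have h1 := hrun (M - 5) (by omega)
      rw [show 2 + (M - 5) = M - 3 by omega, Even.neg_one_pow] at h1
      · have e1 := blockSign_succ_of_true b2
        have e2 := blockSign_succ_of_false (c := b) (j := M - 3 + 1) (by
          rw [← b3]; congr 1; omega)
        have e3 := blockSign_succ_of_true (c := b) (j := M - 3 + 1 + 1) (by
          rw [← h]; congr 1; omega)
        rw [show M - 3 + 1 + 1 + 1 = M by omega, e2, e1, h1, bs] at e3
        norm_num at e3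
      · obtain ⟨k, rfl⟩ := hodd; exact ⟨k - 2, by omega⟩
    refine ⟨p, Or.inr (eq_of_periodic (b := b) (by omega) bper (blocks₄_add M) fun j hj => ?_)⟩
    rw [hM4 j hj]
    rcases Nat.lt_or_ge j 2 with h | h
    · interval_cases j
      · rw [b0]; simp; omega
      · rw [b1]; simp
    · rcases Nat.lt_or_ge j (M - 3) with h' | h'
      · rw [bgap j h (by omega)]; simp; omega
      · obtain rfl | rfl | rfl : j = M - 3 ∨ j = M - 2 ∨ j = M - 1 := by omega
        · rw [b2]; simp
        · rw [b3]; simp; omega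
        · rw [b4]; simp; omega

/-- Here `blocks₄ 5` has adjacent zero blocks, so only runs of three are excluded. Together with the
sign over a period this leaves seven of the sixteen cases. -/
lemma blocks_classification_five {c : ℕ → Bool} (hc : ∀ j, c (j + 5) = c j) (h0 : c 0 = false)
    (hadj : ∀ j, c (j + 2) = true → c (j + 1) = true → c j = false) (hs : blockSign c 5 = -1) :
    (∀ j, c j = false) ∨ ∃ p, (∀ j, c (p + j) = blocks₃ 5 j) ∨ ∀ j, c (p + j) = blocks₄ 5 j := by
  have key : ∀ (b : ℕ → Bool), (∀ j, b (j + 5) = b j) → ∀ p,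
      (∀ j < 5, c (p + j) = b j) → ∀ j, c (p + j) = b j := fun b hb p h =>
    eq_of_periodic (by norm_num) (fun j => by rw [← add_assoc, hc]) hb h
  have c5 := hc 0
  have c6 := hc 1
  have c7 := hc 2
  have h1 := hadj 1
  have h2 := hadj 2
  have v3 : ∀ j < 5, blocks₃ 5 j = decide (j = 1 ∨ j = 4) := by decide
  have v4 : ∀ j < 5, blocks₄ 5 j = decide (j = 1 ∨ j = 2) := by decide
  have t3 := fun p => key _ (blocks₃_add 5) p
  have t4 := fun p => key _ (blocks₄_add 5) p
  have t2 := key (fun _ => false) (fun _ => rfl) 0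
  simp only [zero_add] at t2
  simp only [Nat.reduceAdd] at *
  simp only [blockSign, Finset.prod_range_succ, Finset.prod_range_zero, h0] at hs
  rcases Bool.eq_false_or_eq_true (c 1) with e1 | e1 <;>
  rcases Bool.eq_false_or_eq_true (c 2) with e2 | e2 <;>
  rcases Bool.eq_false_or_eq_true (c 3) with e3 | e3 <;>
  rcases Bool.eq_false_or_eq_true (c 4) with e4 | e4 <;>
  simp [e1, e2, e3, e4] at hs h1 h2
  · exact Or.inr ⟨0, Or.inr (t4 0 fun j hj => by interval_cases j <;> simp [*])⟩
  · exact Or.inr ⟨2, Or.inl (t3 2 fun j hj => by interval_cases j <;> simp [*])⟩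
  · exact Or.inr ⟨0, Or.inl (t3 0 fun j hj => by interval_cases j <;> simp [*])⟩
  · exact Or.inr ⟨1, Or.inr (t4 1 fun j hj => by interval_cases j <;> simp [*])⟩
  · exact Or.inr ⟨3, Or.inl (t3 3 fun j hj => by interval_cases j <;> simp [*])⟩
  · exact Or.inr ⟨2, Or.inr (t4 2 fun j hj => by interval_cases j <;> simp [*])⟩
  · exact Or.inl (t2 fun j hj => by interval_cases j <;> simp [*])

/-- A nonzero antiperiodic word that is maximal among its signed shifts and at most the fourth
word has a signed shift among the three extremal words. -/
lemma classification {a : ℕ → ℤ} {M : ℕ} (hM : 5 ≤ M) (hodd : Odd M) (hmax : ShiftsLE a a)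
    (hw : ShiftsLE a (blockWord (blocks₄ M))) (ha : ∀ j, a (j + 4 * M) = -a j)
    (h0 : ∃ i, a i ≠ 0) : ∃ i, ∃ ε : ℤ, (ε = 1 ∨ ε = -1) ∧
      ((∀ j, ε * a (i + j) = blockWord (fun _ => false) j) ∨
      (∀ j, ε * a (i + j) = blockWord (blocks₃ M) j) ∨
      ∀ j, ε * a (i + j) = blockWord (blocks₄ M) j) := by
  have hM4 : ∀ i, i < M → (blocks₄ M i = decide (i = 1 ∨ i = M - 3)) := fun i hi => by
    simp [blocks₄, Nat.mod_eq_of_lt hi]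
  have d0 : blocks₄ M 0 = false := by rw [hM4 _ (by omega)]; simp; omega
  have d1 : blocks₄ M 1 = true := by rw [hM4 _ (by omega)]; simp
  have hd := fun r (hr : r < 4) => blockWord_mul_add (blocks₄ M) 0 hr
  simp only [mul_zero, zero_add, blockSign_zero, one_mul, d0] at hd
  have hd4 := blockWord_mul_add (blocks₄ M) 1 (r := 0) (by norm_num)
  rw [blockSign_succ_of_false d0] at hd4
  have hr := hw.localRules (by rw [hd 0 (by norm_num)]; rfl) (by rw [hd 1 (by norm_num)]; rfl)
    (by rw [hd 2 (by norm_num)]; rfl) (by rw [hd 3 (by norm_num)]; rfl) (by simpa [block] using hd4)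
  obtain ⟨a0, a1, a2, a3⟩ := prefix_of_shiftsLE hr hmax h0 ha
  set c := readBlock a with hc
  have hcM : ∀ j, c (j + M) = c j := fun j => by
    have := ha (4 * j + 3)
    simp only [hc, readBlock]
    rw [show 4 * (j + M) + 3 = 4 * j + 3 + 4 * M by ring, this]
    simp
  have c0 : c 0 = false := by simp [hc, readBlock, a3]
  obtain ⟨hword, hcl⟩ : (∀ k, a k = blockWord c k) ∧ (blockSign c M = -1 → (∀ j, c j = false) ∨
      ∃ p, (∀ j, c (p + j) = blocks₃ M j) ∨ ∀ j, c (p + j) = blocks₄ M j) := by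
    -- The bound begins false, true, true, false for M = 5 and false, true, false for M ≥ 7; hence
    -- the run lengths H = 2 and H = 1.
    by_cases h5 : M = 5
    · subst h5
      have hp := parse_blocks (H := 2) hr hw d0 (by decide) (by decide) a0 a1 a2 a3
      refine ⟨fun k => (hp k).1 k (by omega), fun hs => ?_⟩
      refine blocks_classification_five hcM c0 (fun j e2 e1 => ?_) hs
      obtain ⟨-, h, hH, hj, hf, -⟩ := hp (j + 2)
      rw [← hc] at hf
      interval_cases h
      · rw [Nat.sub_zero, e2] at hf; simp at hf
      · rw [show j + 2 - 1 = j + 1 by omega, e1] at hf; simp at hf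
      · simpa using hf
    · have hM7 : 7 ≤ M := by obtain ⟨k, rfl⟩ := hodd; omega
      have hp := parse_blocks (H := 1) hr hw d0
        (fun j h1 h2 => by rw [show j = 1 by omega]; exact d1)
        (by rw [hM4 _ (by omega)]; simp; omega) a0 a1 a2 a3
      have hword : ∀ k, a k = blockWord c k := fun k => (hp k).1 k (by omega)
      refine ⟨hword, fun hs => blocks_classification hM7 hodd hcM c0 (fun j e1 => ?_) hs
        fun p hlt => ?_⟩
      · obtain ⟨-, h, hH, hj, hf, -⟩ := hp (j + 1)
        rw [← hc] at hf
        interval_cases h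
        · rw [Nat.sub_zero, e1] at hf; simp at hf
        · simpa using hf
      · refine hw.not_lexLT (4 * p) (blockSign_eq_or c p) ?_
        convert hlt using 2 with k
        rw [hword, blockWord_shift, ← mul_assoc, blockSign_mul_self, one_mul]
  have hs : blockSign c M = -1 := by
    have h1 := ha 0
    have h2 := blockWord_mul_add c M (r := 0) (by norm_num)
    rw [zero_add, hword, a0] at h1
    rw [add_zero, h1] at h2
    simpa [block] using h2.symm
  have hshift : ∀ p k, blockSign c p * a (4 * p + k) = blockWord (fun i => c (p + i)) k :=
    fun p k => by rw [hword, blockWord_shift, ← mul_assoc, blockSign_mul_self, one_mul]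
  rcases hcl hs with h | ⟨p, h | h⟩
  · refine ⟨0, 1, by simp, Or.inl fun j => ?_⟩
    rw [zero_add, one_mul, hword]
    exact blockWord_congr fun i _ => h i
  · refine ⟨4 * p, _, blockSign_eq_or c p, Or.inr (Or.inl fun j => ?_)⟩
    rw [hshift]
    exact blockWord_congr fun i _ => h i
  · refine ⟨4 * p, _, blockSign_eq_or c p, Or.inr (Or.inr fun j => ?_)⟩
    rw [hshift]
    exact blockWord_congr fun i _ => h i

/-! ### The four largest coset leaders -/

/-- An antiperiodic expansion whose word is strictly maximal. -/
structure IsExtremal (q n : ℤ) (L : ℕ) (X w : ℕ → ℤ) : Prop where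
  exp : IsExpansion q n X w
  anti : ∀ j, X (j + L) = -X j
  max : StrictMaximal L w
  one_lt : 1 < L

lemma isExtremal_wordValue {q : ℤ} (hq : 3 ≤ q) {m L : ℕ} {w : ℕ → ℤ}
    (hm : ∀ j, w (j + m) = -w j) (hL : ∀ j, w (j + L) = -w j) (h1 : ∀ j, |w j| ≤ 1)
    (hmax : StrictMaximal L w) (h1L : 1 < L) :
    IsExtremal q (q ^ m + 1) L (wordValue q m w) w := by
  refine ⟨isExpansion_wordValue hq hm h1, fun j => ?_, hmax, h1L⟩
  unfold wordValue
  rw [← Finset.sum_neg_distrib]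
  refine Finset.sum_congr rfl fun k _ => ?_
  rw [show j + L + k = j + k + L by ring, hL]
  ring

section

variable {q n N s m L : ℕ} {X a Y w : ℕ → ℤ}

lemma IsExtremal.pos (h : IsExtremal q n L X w) : 0 < X 0 :=
  (abs_nonneg _).trans_lt (abs_lt_of_strictMaximal h.exp h.max one_pos h.one_lt)

lemma IsExtremal.abs_le (h : IsExtremal q n L X w) (j : ℕ) : |X j| ≤ X 0 :=
  abs_le_of_strictMaximal h.exp (by have := h.one_lt; omega) h.max h.pos h.anti j

lemma IsExtremal.isCosetLeader (h : IsExtremal q n L X w) (hq : Odd q) (hn : n = 2 * N)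
    (hs : (s : ℤ) = N - X 0) : IsCosetLeader q n s :=
  (isCosetLeader_iff hq hn h.exp hs).2 fun j => (le_abs_self _).trans (h.abs_le j)

lemma IsExtremal.ncard (h : IsExtremal q n L X w) (hq : Odd q) (hn : n = 2 * N)
    (hs : (s : ℤ) = N - X 0) : (cyclotomicCoset q n s).ncard = 2 * L :=
  ncard_cyclotomicCoset hq hn h.exp hs (by have := h.one_lt; omega) h.max h.pos h.anti

/-- Each of X 0 and Y 0 is the maximum of the absolute values on its orbit, and up to sign the orbit
of Y is a tail of that of X. The tail still contains ±X 0, at multiples of m. -/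
lemma IsExtremal.value_eq (hY : IsExtremal q n L Y w) (hq : 3 ≤ q) (hX : IsExpansion q n X a)
    (hm : 0 < m) (ha : ∀ j, X (j + m) = -X j) (hmax : ∀ j, |X j| ≤ X 0) {i : ℕ} {ε : ℤ}
    (hε : ε = 1 ∨ ε = -1) (h : ∀ j, ε * a (i + j) = w j) : X 0 = Y 0 := by
  have hq' : (2 : ℤ) ≤ q := by exact_mod_cast (by omega : 2 ≤ q)
  have key : ∀ j, ε * X (i + j) = Y j := fun j => by
    have h1 := ((hX.shift (i + j)).smul hε).eq_of_digits (hY.exp.shift j) hq' fun k => by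
      rw [add_assoc]; exact h (j + k)
    simpa using h1
  have habs : ∀ j, |X (i + j)| = |Y j| := fun j => by
    rw [← key j, abs_mul]; rcases hε with rfl | rfl <;> simp
  have hX0 : 0 ≤ X 0 := (abs_nonneg _).trans (hmax 0)
  have hper : ∀ k, |X (k * m)| = X 0 := fun k => by
    induction k with
    | zero => simpa using hX0
    | succ k ih => rw [Nat.succ_mul, ha, abs_neg, ih]
  have h1 := hmax i
  have h2 := habs 0
  rw [add_zero, abs_of_pos hY.pos] at h2
  have h3 := habs (i * m - i)
  rw [Nat.add_sub_cancel' (Nat.le_mul_of_pos_right i hm), hper] at h3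
  have h4 := hY.abs_le (i * m - i)
  omega

/-- A coset leader that is at least the one belonging to `Z` is `n / 2` or its word has a signed
shift to which the classification of words applies. -/
lemma leader_word (hq : Odd q) (hq3 : 3 ≤ q) (hn : n = 2 * N) (hm : n = q ^ m + 1)
    {Z d : ℕ → ℤ} (hZ : IsExtremal q n L Z d) (hl : IsCosetLeader q n s)
    (hle : (N : ℤ) - Z 0 ≤ s) : s = N ∨ ∃ X a, IsExpansion q n X a ∧ (s : ℤ) = N - X 0 ∧
      (∀ j, X (j + m) = -X j) ∧ (∀ j, |X j| ≤ X 0) ∧ ShiftsLE a a ∧ ShiftsLE a d ∧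
      (∀ j, a (j + m) = -a j) ∧ ∃ i, a i ≠ 0 := by
  have hq' : (2 : ℤ) ≤ q := by exact_mod_cast (by omega : 2 ≤ q)
  have hs0 : 0 < s := by
    have h1 := hZ.exp.lt 0
    have h2 := le_abs_self (Z 0)
    omega
  obtain ⟨X, a, hX, hs, hXa, ha⟩ := exists_expansion_of_leader hq hn hs0 hl hm
  have hmax := (isCosetLeader_iff hq hn hX hs).1 hl
  by_cases h0 : ∃ i, a i ≠ 0
  · refine Or.inr ⟨X, a, hX, hs, hXa, fun j => ?_, ?_, ?_, ha, h0⟩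
    · have := hmax (j + m); rw [hXa] at this
      exact abs_le.2 ⟨by linarith, hmax j⟩
    all_goals
      intro i ε hε k hk
      have h1 : ε * X i ≤ X 0 := by
        have := hmax (i + m); rw [hXa] at this
        have := hmax i
        rcases hε with rfl | rfl <;> omega
    · exact ((hX.shift i).smul hε).digit_le hX (by omega) (by simpa using h1) hk
    · exact ((hX.shift i).smul hε).digit_le hZ.exp (by omega)
        (by simp only [add_zero]; omega) hk
  · left
    push Not at h0
    have hz : IsExpansion q n (fun _ => 0) (fun _ => 0) :=
      ⟨by simp, fun j => by simpa using hX.pos⟩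
    have := hX.eq_of_digits hz hq' h0
    omega

/-- The four largest coset leaders. -/
lemma exists_leaders (hq : Odd q) (hq3 : 3 ≤ q) (hm : 12 ≤ m) (hm8 : m % 8 = 4)
    (hn : n = q ^ m + 1) : ∃ δ₁ δ₂ δ₃ δ₄ : ℕ,
      ((δ₁ : ℚ) = (n : ℚ) / 2 ∧ (δ₂ : ℚ) = Delta2 q m ∧ (δ₃ : ℚ) = Delta3 q m ∧
        (δ₄ : ℚ) = Delta4 q m) ∧
      (0 < δ₄ ∧ δ₄ < δ₃ ∧ δ₃ < δ₂ ∧ δ₂ < δ₁) ∧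
      (IsCosetLeader q n δ₁ ∧ IsCosetLeader q n δ₂ ∧ IsCosetLeader q n δ₃ ∧
        IsCosetLeader q n δ₄) ∧
      ((cyclotomicCoset q n δ₁).ncard = 1 ∧ (cyclotomicCoset q n δ₂).ncard = 8 ∧
        (cyclotomicCoset q n δ₃).ncard = 2 * m ∧ (cyclotomicCoset q n δ₄).ncard = 2 * m) ∧
      ∀ s, IsCosetLeader q n s → δ₄ ≤ s → s = δ₁ ∨ s = δ₂ ∨ s = δ₃ ∨ s = δ₄ := by
  obtain ⟨M, rfl⟩ : ∃ M, m = 4 * M := ⟨m / 4, by omega⟩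
  have hM : 3 ≤ M := by omega
  have hodd : Odd M := ⟨M / 2, by omega⟩
  obtain ⟨N, hN⟩ : ∃ N, n = 2 * N := by
    obtain ⟨k, hk⟩ := hq.pow (n := 4 * M)
    exact ⟨k + 1, by omega⟩
  have hnz : (n : ℤ) = (q : ℤ) ^ (4 * M) + 1 := by exact_mod_cast hn
  have hq3' : (3 : ℤ) ≤ q := by exact_mod_cast hq3
  have hsM : blockSign (fun _ => false) M = -1 := by simpa [blockSign] using hodd.neg_one_pow
  -- The modulus uses the antiperiod 4M, valid because M is odd, while the coset size 8 comes from
  -- the shorter antiperiod 4.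
  have E2 := isExtremal_wordValue hq3' (m := 4 * M)
    (blockWord_add_period (M := M) (c := fun _ => false) (fun _ => rfl) hsM)
    (blockWord_add_period (M := 1) (c := fun _ => false) (fun _ => rfl) (by simp [blockSign]))
    (abs_blockWord_le _) strictMaximal_blocks₂ (by norm_num)
  have p3 := blockWord_add_period (blocks₃_add M) (blockSign_blocks₃ hM hodd)
  have E3 := isExtremal_wordValue hq3' p3 p3 (abs_blockWord_le _)
    (strictMaximal_blocks₃ hM hodd) (by omega)
  rw [← hnz] at E2 E3
  have v2 := value_blocks₂ E2.exp (E2.anti 0)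
  have v3 := value_blocks₃ hM hodd hnz E3.exp (by simpa using E3.anti 0)
  set X2 := wordValue q (4 * M) (blockWord fun _ => false) with hX2
  set X3 := wordValue q (4 * M) (blockWord (blocks₃ M)) with hX3
  -- Both shapes of the fourth word are treated alike from here on. For M ≥ 5 the factor q⁴ - 1 is
  -- (q⁸ - 1)/(q⁴ + 1).
  obtain ⟨d, X4, E4, v4, hcl⟩ : ∃ d X4, IsExtremal q n (4 * M) X4 d ∧
      X4 0 = X3 0 + (if 4 * M = 12 then (q : ℤ) ^ 2 else (q : ℤ) ^ 4 - 1)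
        * ((q : ℤ) ^ 2 - 1) * ((q : ℤ) - 1) ^ 2 ∧
      ∀ a : ℕ → ℤ, ShiftsLE a a → ShiftsLE a d → (∀ j, a (j + 4 * M) = -a j) → (∃ i, a i ≠ 0) →
        ∃ i, ∃ ε : ℤ, (ε = 1 ∨ ε = -1) ∧
          ((∀ j, ε * a (i + j) = blockWord (fun _ => false) j) ∨
          (∀ j, ε * a (i + j) = blockWord (blocks₃ M) j) ∨ ∀ j, ε * a (i + j) = d j) := by
    have hc : (q : ℤ) ^ 4 + 1 ≠ 0 := by positivity
    by_cases h3 : M = 3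
    · subst h3
      have E4 := isExtremal_wordValue hq3' word₁₂_add word₁₂_add abs_word₁₂_le
        strictMaximal_word₁₂ (by norm_num)
      refine ⟨_, _, hnz ▸ E4, ?_, fun a hmax hd ha h0 => ⟨0, 1, by simp, ?_⟩⟩
      · rw [value_word₁₂, if_pos rfl]
        refine mul_right_cancel₀ hc ?_
        rw [add_mul (X3 0), v3, hnz]
        ring
      · simpa using classification₁₂ hmax hd ha h0
    · have hM5 : 5 ≤ M := by obtain ⟨k, rfl⟩ := hodd; omega
      have p4 := blockWord_add_period (blocks₄_add M) (blockSign_blocks₄ hM5 hodd)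
      have E4 := isExtremal_wordValue hq3' p4 p4 (abs_blockWord_le _)
        (strictMaximal_blocks₄ hM5 hodd) (by omega)
      rw [← hnz] at E4
      have v4 := value_blocks₄ hM5 hodd hnz E4.exp (by simpa using E4.anti 0)
      refine ⟨_, _, E4, ?_, fun a hmax hd ha h0 => classification hM5 hodd hmax hd ha h0⟩
      rw [if_neg (by omega)]
      refine mul_right_cancel₀ hc ?_
      rw [add_mul, v3, v4]
      ring
  have hlt : ∀ {L X w}, IsExtremal q n L X w → X 0 < N := fun {L X w} h => by
    have h1 := h.exp.lt 0
    have h2 := le_abs_self (X 0)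
    omega
  have hδ : ∀ {L X w}, IsExtremal q n L X w → ((N - X 0).toNat : ℤ) = N - X 0 :=
    fun {L X w} h => by have := hlt h; omega
  have l2 := hlt E2
  have l3 := hlt E3
  have l4 := hlt E4
  have pos2 := E2.pos
  have d2 := hδ E2
  have d3 := hδ E3
  have d4 := hδ E4
  set δ₂ := (N - X2 0).toNat
  set δ₃ := (N - X3 0).toNat
  set δ₄ := (N - X4 0).toNat
  have hq2 : 0 < (q : ℤ) ^ 2 - 1 := by nlinarith
  have hq1 : 0 < ((q : ℤ) - 1) ^ 2 := by have : 0 < (q : ℤ) - 1 := by omega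
                                         positivity
  have hq4 : 0 < (q : ℤ) ^ 4 - 1 := by nlinarith
  have o23 : X2 0 < X3 0 := by
    have h1 : 0 < ((q : ℤ) - 1) ^ 2 * ((q : ℤ) ^ 2 - 1) * (1 + (q : ℤ) ^ (4 * M - 8)) := by
      positivity
    have h2 : X2 0 * ((q : ℤ) ^ 4 + 1) < X3 0 * ((q : ℤ) ^ 4 + 1) := by rw [v2, v3]; linarith
    exact lt_of_mul_lt_mul_right h2 (by positivity)
  have o34 : X3 0 < X4 0 := by
    rw [v4]
    have : 0 < (if 4 * M = 12 then (q : ℤ) ^ 2 else (q : ℤ) ^ 4 - 1) := by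
      split_ifs
      · positivity
      · exact hq4
    have : 0 < (if 4 * M = 12 then (q : ℤ) ^ 2 else (q : ℤ) ^ 4 - 1)
        * ((q : ℤ) ^ 2 - 1) * ((q : ℤ) - 1) ^ 2 := by positivity
    linarith
  have hz : IsExpansion q n (fun _ => 0) (fun _ => 0) :=
    ⟨by simp, fun j => by simpa using E2.exp.pos⟩
  have hNZ : (N : ℤ) = N - (fun _ => 0 : ℕ → ℤ) 0 := by simp
  have hn0 : 0 < n := by omega
  have : NeZero n := ⟨hn0.ne'⟩
  have hNq : (N : ℚ) = (n : ℚ) / 2 := by rw [hN]; push_cast; ring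
  have hnq : (n : ℚ) = (q : ℚ) ^ (4 * M) + 1 := by exact_mod_cast hnz
  have hcq : (q : ℚ) ^ 4 + 1 ≠ 0 := by positivity
  have f2 : (δ₂ : ℚ) = (n : ℚ) / 2 - X2 0 := by rw [← hNq]; exact_mod_cast d2
  have f3 : (δ₃ : ℚ) = (n : ℚ) / 2 - X3 0 := by rw [← hNq]; exact_mod_cast d3
  have f4 : (δ₄ : ℚ) = (n : ℚ) / 2 - X4 0 := by rw [← hNq]; exact_mod_cast d4
  have w2 : (X2 0 : ℚ) = n * ((q : ℚ) ^ 3 - q + 1) / ((q : ℚ) ^ 4 + 1) := by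
    rw [eq_div_iff hcq]; exact_mod_cast v2
  have w3 : (X3 0 : ℚ) = (n * ((q : ℚ) ^ 3 - q + 1) + ((q : ℚ) - 1) ^ 2 * ((q : ℚ) ^ 2 - 1) *
      (1 + (q : ℚ) ^ (4 * M - 8))) / ((q : ℚ) ^ 4 + 1) := by
    rw [eq_div_iff hcq]; exact_mod_cast v3
  have F3 : (δ₃ : ℚ) = Delta3 q (4 * M) := by
    rw [f3, w3, hnq, Delta3]
    field_simp
    ring
  refine ⟨N, δ₂, δ₃, δ₄, ⟨hNq, ?_, F3, ?_⟩, ⟨by omega, by omega, by omega, by omega⟩,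
    ⟨(isCosetLeader_iff hq hN hz hNZ).2 (by simp), E2.isCosetLeader hq hN d2,
      E3.isCosetLeader hq hN d3, E4.isCosetLeader hq hN d4⟩,
    ⟨?_, E2.ncard hq hN d2, E3.ncard hq hN d3, E4.ncard hq hN d4⟩, ?_⟩
  · rw [f2, w2, hnq, Delta2]
    field_simp
    ring
  · have : (X4 0 : ℚ) = X3 0 + (if 4 * M = 12 then (q : ℚ) ^ 2 else (q : ℚ) ^ 4 - 1)
        * ((q : ℚ) ^ 2 - 1) * ((q : ℚ) - 1) ^ 2 := by
      rw [v4]; split_ifs <;> push_cast <;> ring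
    rw [f4, this, Delta4, ← F3, f3]
    split_ifs <;> ring
  · have : cyclotomicCoset q n N = {(N : ZMod n)} := by
      ext x
      have key : ∀ j, (N : ZMod n) * (q : ZMod n) ^ j = N := fun j => by
        apply ZMod.val_injective n
        have h1 := coset_val hq hN hz hNZ j
        have h2 := coset_val hq hN hz hNZ 0
        rw [pow_zero, mul_one] at h2
        omega
      simp [cyclotomicCoset, key]
    rw [this, Set.ncard_singleton]
  · intro s hl hs
    rcases leader_word hq hq3 hN hn E4 hl (by omega) with h | ⟨X, a, hX, hXs, hXm, hXmax, h1, h2, h3, h4⟩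
    · exact Or.inl h
    obtain ⟨i, ε, hε, h | h | h⟩ := hcl a h1 h2 h3 h4
    · have := E2.value_eq hq3 hX (by omega) hXm hXmax hε h
      omega
    · have := E3.value_eq hq3 hX (by omega) hXm hXmax hε h
      omega
    · have := E4.value_eq hq3 hX (by omega) hXm hXmax hε h
      omega

end

/-! ### Cyclic codes -/

section Cyclic

variable {F : Type*} [Field F] {n : ℕ}

/-- The polynomial `c₀ + c₁x + ⋯ + cₙ₋₁xⁿ⁻¹` of a word. -/
def wordPoly (F : Type*) [Field F] (n : ℕ) : (Fin n → F) →ₗ[F] F[X] where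
  toFun c := ∑ i : Fin n, C (c i) * X ^ (i : ℕ)
  map_add' a b := by simp [add_mul, Finset.sum_add_distrib]
  map_smul' r a := by simp [smul_eq_C_mul, mul_assoc, Finset.mul_sum]

lemma aeval_wordPoly {K : Type*} [CommRing K] [Algebra F K] (x : K) (c : Fin n → F) :
    aeval x (wordPoly F n c) = ∑ i : Fin n, algebraMap F K (c i) * x ^ (i : ℕ) := by
  simp [wordPoly]

lemma mem_cyclicCode_iff {g : F[X]} (hg : g ∣ X ^ n - 1) (c : Fin n → F) :
    c ∈ cyclicCode n g ↔ g ∣ wordPoly F n c := by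
  have h1 : c ∈ cyclicCode n g ↔ ∃ h, AdjoinRoot.mk ((X : F[X]) ^ n - 1) (wordPoly F n c) =
      AdjoinRoot.mk ((X : F[X]) ^ n - 1) g * h := by
    change wordClass F n c ∈ Ideal.span _ ↔ _
    rw [Ideal.mem_span_singleton]
    rfl
  rw [h1]
  constructor
  · rintro ⟨h, hh⟩
    obtain ⟨h, rfl⟩ := AdjoinRoot.mk_surjective h
    rw [← map_mul, AdjoinRoot.mk_eq_mk] at hh
    have := dvd_add (hg.trans hh) (dvd_mul_right g h)
    rwa [sub_add_cancel] at this
  · rintro ⟨h, hh⟩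
    exact ⟨AdjoinRoot.mk _ h, by rw [hh, map_mul]⟩

lemma exists_wordPoly_eq {f : F[X]} (hf : f.natDegree < n) :
    ∃ c, wordPoly F n c = f := by
  refine ⟨fun i => f.coeff i, ?_⟩
  conv_rhs => rw [f.as_sum_range_C_mul_X_pow' hf, Finset.sum_range]
  rfl

lemma exists_wordPoly_mod (hn : 0 < n) (f : F[X]) :
    ∃ c h, wordPoly F n c = f + (X ^ n - 1) * h := by
  have hm : (X ^ n - 1 : F[X]).Monic := monic_X_pow_sub_C 1 hn.ne'
  have hd : (X ^ n - 1 : F[X]).natDegree = n := natDegree_X_pow_sub_C (r := (1 : F))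
  obtain ⟨c, hc⟩ := exists_wordPoly_eq (f := f %ₘ (X ^ n - 1)) (by
    have := natDegree_modByMonic_lt f hm (by intro h; rw [h] at hd; simp at hd; omega)
    rwa [hd] at this)
  refine ⟨c, -(f /ₘ (X ^ n - 1)), ?_⟩
  have := modByMonic_add_div f (X ^ n - 1 : F[X])
  rw [hc]
  linear_combination this

lemma finrank_cyclicCode (hn : 0 < n) {g : F[X]} (hg : g ∣ X ^ n - 1) :
    Module.finrank F (cyclicCode n g) + g.natDegree = n := by
  set φ : (Fin n → F) →ₗ[F] F[X] ⧸ Ideal.span {g} :=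
    (Ideal.Quotient.mkₐ F (Ideal.span {g})).toLinearMap ∘ₗ wordPoly F n with hφ
  have hker : LinearMap.ker φ = cyclicCode n g := by
    ext c
    rw [mem_cyclicCode_iff hg, LinearMap.mem_ker, ← Ideal.mem_span_singleton,
      ← Ideal.Quotient.eq_zero_iff_mem]
    rfl
  have hsurj : Function.Surjective φ := fun y => by
    obtain ⟨f, rfl⟩ := Ideal.Quotient.mk_surjective y
    obtain ⟨c, h, hc⟩ := exists_wordPoly_mod hn f
    refine ⟨c, ?_⟩
    change Ideal.Quotient.mk _ (wordPoly F n c) = _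
    rw [hc, Ideal.Quotient.eq, Ideal.mem_span_singleton, add_sub_cancel_left]
    exact hg.mul_right _
  have h1 := LinearMap.finrank_range_add_finrank_ker φ
  rw [hker, LinearMap.range_eq_top.2 hsurj, finrank_top, finrank_quotient_span_eq_natDegree,
    Module.finrank_fin_fun] at h1
  omega

variable {K : Type*} [Field K] [Algebra F K] {β : K}

lemma card_roots_of_dvd (hn0 : (n : F) ≠ 0) (hβ : IsPrimitiveRoot β n) {g : F[X]}
    (hg : g ∣ X ^ n - 1) :
    Set.ncard {x : ZMod n | aeval (β ^ x.val) g = 0} = g.natDegree := by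
  have hn : n ≠ 0 := by rintro rfl; simp at hn0
  have : NeZero n := ⟨hn⟩
  have hne : (X ^ n - 1 : F[X]) ≠ 0 := (monic_X_pow_sub_C 1 hn).ne_zero
  have hg0 : g ≠ 0 := ne_zero_of_dvd_ne_zero hne hg
  have hsep : g.Separable := (X_pow_sub_one_separable_iff.2 hn0).of_dvd hg
  have hsplit : Splits (g.map (algebraMap F K)) := by
    have h1 : Splits ((X ^ n - 1 : F[X]).map (algebraMap F K)) := by
      simpa using X_pow_sub_one_splits hβ
    exact h1.of_dvd (Polynomial.map_ne_zero hne)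
      (Polynomial.map_dvd _ hg)
  rw [← card_rootSet_eq_natDegree hsep hsplit, ← Nat.card_eq_fintype_card, Nat.card_coe_set_eq]
  refine Set.ncard_congr (fun x _ => β ^ x.val) (fun x hx => ?_) (fun x y _ _ h => ?_)
    fun y hy => ?_
  · rw [mem_rootSet]
    exact ⟨hg0, hx⟩
  · exact ZMod.val_injective n (hβ.pow_inj (ZMod.val_lt _) (ZMod.val_lt _) h)
  · rw [mem_rootSet] at hy
    have hyn : y ^ n = 1 := by
      obtain ⟨h, hh⟩ := hg
      have : aeval y (X ^ n - 1 : F[X]) = 0 := by rw [hh, map_mul, hy.2, zero_mul]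
      simpa [sub_eq_zero] using this
    obtain ⟨i, hi, rfl⟩ := hβ.eq_pow_of_pow_eq_one hyn
    have hv : ((i : ℕ) : ZMod n).val = i := by rw [ZMod.val_natCast, Nat.mod_eq_of_lt hi]
    refine ⟨(i : ZMod n), ?_, ?_⟩
    · simpa [hv] using hy.2
    · rw [hv]

lemma finrank_cyclicCode_eq_ncard (hn0 : (n : F) ≠ 0) (hβ : IsPrimitiveRoot β n) {g : F[X]}
    (hg : g ∣ X ^ n - 1) : Module.finrank F (cyclicCode n g) =
      Set.ncard {x : ZMod n | aeval (β ^ x.val) g ≠ 0} := by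
  have hn : n ≠ 0 := by rintro rfl; simp at hn0
  have : NeZero n := ⟨hn⟩
  have h1 := finrank_cyclicCode (Nat.pos_of_ne_zero hn) hg
  have h2 := card_roots_of_dvd hn0 hβ hg
  have h3 := Set.ncard_add_ncard_compl {x : ZMod n | aeval (β ^ x.val) g = 0}
  rw [Nat.card_zmod] at h3
  have h4 : {x : ZMod n | aeval (β ^ x.val) g = 0}ᶜ = {x : ZMod n | aeval (β ^ x.val) g ≠ 0} := rfl
  rw [h4] at h3
  omega

/-! ### The Euclidean dual -/

lemma sum_pow_mul_inv_pow (hβ : IsPrimitiveRoot β n) (i j : Fin n) :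
    ∑ l : Fin n, (β ^ (l : ℕ)) ^ (i : ℕ) * ((β ^ (l : ℕ))⁻¹) ^ (j : ℕ) =
      if i = j then (n : K) else 0 := by
  have hβ0 : β ≠ 0 := hβ.ne_zero (by have := i.pos; omega)
  have h1 : ∀ l : Fin n, (β ^ (l : ℕ)) ^ (i : ℕ) * ((β ^ (l : ℕ))⁻¹) ^ (j : ℕ) =
      (β ^ (i : ℕ) * (β ^ (j : ℕ))⁻¹) ^ (l : ℕ) := fun l => by
    rw [mul_pow, inv_pow, inv_pow, ← pow_mul, ← pow_mul, ← pow_mul, ← pow_mul,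
      mul_comm (l : ℕ), mul_comm (l : ℕ)]
  simp_rw [h1]
  rw [Fin.sum_univ_eq_sum_range]
  split_ifs with h
  · subst h
    simp [mul_inv_cancel₀ (pow_ne_zero _ hβ0)]
  · set w := β ^ (i : ℕ) * (β ^ (j : ℕ))⁻¹ with hw
    have hw1 : w - 1 ≠ 0 := by
      intro h0
      have h2 : β ^ (i : ℕ) = β ^ (j : ℕ) := by
        rw [hw, sub_eq_zero, ← div_eq_mul_inv, div_eq_one_iff_eq (pow_ne_zero _ hβ0)] at h0
        exact h0
      exact h (Fin.ext (hβ.pow_inj i.2 j.2 h2))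
    have hwn : w ^ n = 1 := by
      rw [hw, mul_pow, inv_pow, ← pow_mul, ← pow_mul, mul_comm (i : ℕ), mul_comm (j : ℕ), pow_mul,
        pow_mul, hβ.pow_eq_one]
      simp
    have h3 := geom_sum_mul w n
    rw [hwn, sub_self] at h3
    exact (mul_eq_zero.1 h3).resolve_right hw1

/-- Parseval's identity for the discrete Fourier transform at the powers of β. -/
lemma sum_aeval_mul_aeval_inv (hβ : IsPrimitiveRoot β n) (x y : Fin n → F) :
    ∑ l : Fin n, aeval (β ^ (l : ℕ)) (wordPoly F n x) * aeval (β ^ (l : ℕ))⁻¹ (wordPoly F n y) =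
      n * algebraMap F K (x ⬝ᵥ y) := by
  simp_rw [aeval_wordPoly, Finset.sum_mul_sum]
  rw [Finset.sum_comm]
  have h1 : ∀ i j : Fin n, ∑ l : Fin n, algebraMap F K (x i) * (β ^ (l : ℕ)) ^ (i : ℕ) *
      (algebraMap F K (y j) * ((β ^ (l : ℕ))⁻¹) ^ (j : ℕ)) =
      algebraMap F K (x i) * algebraMap F K (y j) * if i = j then (n : K) else 0 := fun i j => by
    rw [← sum_pow_mul_inv_pow hβ, Finset.mul_sum]
    exact Finset.sum_congr rfl fun l _ => by ring
  have h2 : ∑ i : Fin n, ∑ j : Fin n, ∑ l : Fin n, algebraMap F K (x i) * (β ^ (l : ℕ)) ^ (i : ℕ) *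
      (algebraMap F K (y j) * ((β ^ (l : ℕ))⁻¹) ^ (j : ℕ)) = n * algebraMap F K (x ⬝ᵥ y) := by
    simp_rw [h1]
    simp [dotProduct, Finset.mul_sum, mul_comm]
  rw [← h2]
  refine Finset.sum_congr rfl fun i _ => ?_
  rw [Finset.sum_comm]

lemma eq_zero_of_aeval_eq_zero (hβ : IsPrimitiveRoot β n) {x : Fin n → F}
    (h : ∀ l : Fin n, aeval (β ^ (l : ℕ)) (wordPoly F n x) = 0) : x = 0 := by
  have hinj : Function.Injective fun l : Fin n => β ^ (l : ℕ) := fun i j hij =>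
    Fin.ext (hβ.pow_inj i.2 j.2 hij)
  have := Matrix.eq_zero_of_forall_index_sum_mul_pow_eq_zero hinj
    (v := fun i => algebraMap F K (x i)) fun l => by rw [← aeval_wordPoly]; exact h l
  funext i
  simpa using congrFun this i

/-- A cyclic code whose zeros are closed under inversion has complementary dual. -/
lemma isLCD_cyclicCode (hn : 0 < n) (hβ : IsPrimitiveRoot β n) {g : F[X]} (hg : g ∣ X ^ n - 1)
    (hinv : ∀ l : ℕ, aeval (β ^ l)⁻¹ g = 0 → aeval (β ^ l) g = 0) : IsLCD (cyclicCode n g) := by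
  rw [IsLCD, eq_bot_iff]
  rintro x ⟨hxC, hxD⟩
  rw [Submodule.mem_bot]
  have hxg := (mem_cyclicCode_iff hg x).1 hxC
  have hβ0 : β ≠ 0 := hβ.ne_zero hn.ne'
  have hinj : Function.Injective fun l : Fin n => (β ^ (l : ℕ))⁻¹ := fun i j hij =>
    Fin.ext (hβ.pow_inj i.2 j.2 (inv_injective hij))
  -- Parseval's identity for x against the codeword of g X^r, for r < n, is a Vandermonde system for
  -- the products x(β^l) g(β^(-l)), so they all vanish. Where g(β^(-l)) = 0, closure under inversion
  -- gives g(β^l) = 0, hence x(β^l) = 0 as g divides x.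
  have hz := Matrix.eq_zero_of_forall_pow_sum_mul_pow_eq_zero hinj
    (v := fun l : Fin n => aeval (β ^ (l : ℕ)) (wordPoly F n x) * aeval (β ^ (l : ℕ))⁻¹ g)
    fun r => by
      obtain ⟨y, h, hy⟩ := exists_wordPoly_mod hn (g * X ^ (r : ℕ))
      have hyC : y ∈ cyclicCode n g := by
        rw [mem_cyclicCode_iff hg, hy]
        exact dvd_add (dvd_mul_right _ _) (hg.mul_right _)
      have h1 := sum_aeval_mul_aeval_inv hβ x y
      rw [hxD y hyC, map_zero, mul_zero] at h1
      rw [← h1]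
      refine Finset.sum_congr rfl fun l _ => ?_
      have h2 : ((β ^ (l : ℕ))⁻¹) ^ n = 1 := by
        rw [inv_pow, ← pow_mul, mul_comm, pow_mul, hβ.pow_eq_one, one_pow, inv_one]
      rw [hy]
      simp [h2, mul_assoc]
  refine eq_zero_of_aeval_eq_zero hβ fun l => ?_
  rcases mul_eq_zero.1 (congrFun hz l) with h | h
  · exact h
  · obtain ⟨k, hk⟩ := hxg
    rw [hk, map_mul, hinv l h, zero_mul]

/-! ### The BCH bound -/

/-- If the weight were at most D, the equations would contain an invertible Vandermonde system on
the support of x. -/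
lemma bch_bound (hβ : IsPrimitiveRoot β n) (hn : 0 < n) {x : Fin n → F} {D : ℕ} {b : ℤ}
    (h : ∀ j < D, ∑ i : Fin n, algebraMap F K (x i) * (β ^ (i : ℕ)) ^ (b + j) = 0)
    (hx : x ≠ 0) [DecidableEq F] : D < hammingNorm x := by
  by_contra hlt
  rw [not_lt] at hlt
  have hβ0 : β ≠ 0 := hβ.ne_zero hn.ne'
  set S : Finset (Fin n) := {i | x i ≠ 0} with hS
  have hcard : S.card = hammingNorm x := rfl
  set e := S.equivFin with he
  have hz := Matrix.eq_zero_of_forall_pow_sum_mul_pow_eq_zero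
    (f := fun k : Fin S.card => β ^ ((e.symm k : Fin n) : ℕ))
    (fun i j hij => by
      have := hβ.pow_inj (Fin.is_lt _) (Fin.is_lt _) hij
      exact e.symm.injective (Subtype.ext (Fin.ext this)))
    (v := fun k => algebraMap F K (x (e.symm k)) * (β ^ ((e.symm k : Fin n) : ℕ)) ^ b)
    fun j => by
      rw [← h j (by omega)]
      have h1 : ∀ i : Fin n, i ∉ S → algebraMap F K (x i) * (β ^ (i : ℕ)) ^ (b + (j : ℕ)) = 0 :=
        fun i hi => by
          have : x i = 0 := by simpa [hS] using hi
          simp [this]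
      rw [← Finset.sum_subset (Finset.subset_univ S) fun i _ hi => h1 i hi,
        ← Finset.sum_coe_sort S fun i => algebraMap F K (x i) * (β ^ (i : ℕ)) ^ (b + (j : ℕ)),
        ← e.symm.sum_comp]
      refine Finset.sum_congr rfl fun k _ => ?_
      rw [zpow_add₀ (pow_ne_zero _ hβ0), zpow_natCast, mul_assoc]
  apply hx
  funext i
  by_contra hi
  have hiS : i ∈ S := by simpa [hS] using hi
  have h2 := congrFun hz (e ⟨i, hiS⟩)
  simp [hβ0, zpow_ne_zero] at h2
  exact hi h2

end Cyclic

/-! ### Cyclotomic cosets as orbits -/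

section Orbit

variable {q n : ℕ}

lemma exists_pow_eq_one [NeZero n] (hu : IsUnit (q : ZMod n)) :
    ∃ k, 0 < k ∧ (q : ZMod n) ^ k = 1 := by
  obtain ⟨u, hu⟩ := hu
  exact ⟨orderOf u, orderOf_pos u, by rw [← hu, ← Units.val_pow_eq_pow_val, pow_orderOf_eq_one]; rfl⟩

lemma mem_coset_self (s : ℕ) : (s : ZMod n) ∈ cyclotomicCoset q n s := ⟨0, by simp⟩

lemma coset_symm [NeZero n] (hu : IsUnit (q : ZMod n)) {s t : ℕ}
    (h : (t : ZMod n) ∈ cyclotomicCoset q n s) : (s : ZMod n) ∈ cyclotomicCoset q n t := by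
  obtain ⟨j, hj⟩ := h
  obtain ⟨k, hk, hk1⟩ := exists_pow_eq_one hu
  refine ⟨j * k - j, ?_⟩
  rw [hj, mul_assoc, ← pow_add, Nat.add_sub_cancel' (Nat.le_mul_of_pos_right j hk), mul_comm j,
    pow_mul, hk1, one_pow, mul_one]

lemma coset_trans {s t : ℕ} {x : ZMod n} (h : (t : ZMod n) ∈ cyclotomicCoset q n s)
    (hx : x ∈ cyclotomicCoset q n t) : x ∈ cyclotomicCoset q n s := by
  obtain ⟨j, hj⟩ := h
  obtain ⟨k, rfl⟩ := hx
  exact ⟨j + k, by rw [hj, pow_add, mul_assoc]⟩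

lemma exists_leader [NeZero n] (hu : IsUnit (q : ZMod n)) (x : ZMod n) :
    ∃ s, IsCosetLeader q n s ∧ x ∈ cyclotomicCoset q n s := by
  classical
  have hx : ((x.val : ℕ) : ZMod n) = x := ZMod.natCast_zmod_val x
  have hex : ∃ s, ∃ y ∈ cyclotomicCoset q n x.val, y.val = s :=
    ⟨_, _, mem_coset_self x.val, rfl⟩
  obtain ⟨y, hy, hys⟩ := Nat.find_spec hex
  set s := Nat.find hex
  have hsy : (s : ZMod n) = y := by rw [← hys]; exact ZMod.natCast_zmod_val y
  rw [← hsy] at hy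
  refine ⟨s, ⟨by rw [← hys]; exact ZMod.val_lt y, fun z hz => ?_⟩, ?_⟩
  · exact Nat.find_min' hex ⟨z, coset_trans hy hz, rfl⟩
  · have := coset_symm hu hy
    rwa [hx] at this

lemma leader_le [NeZero n] (hu : IsUnit (q : ZMod n)) {s i : ℕ} (hs : IsCosetLeader q n s)
    {x : ZMod n} (hx : x ∈ cyclotomicCoset q n s) (hi : x ∈ cyclotomicCoset q n i) (hin : i < n) :
    s ≤ i := by
  rw [← ZMod.natCast_zmod_val x] at hi
  have h1 := coset_symm hu hi
  rw [← ZMod.natCast_zmod_val x] at hx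
  have := hs.2 _ (coset_trans hx h1)
  rwa [ZMod.val_natCast, Nat.mod_eq_of_lt hin] at this

lemma leader_unique [NeZero n] (hu : IsUnit (q : ZMod n)) {s t : ℕ} (hs : IsCosetLeader q n s)
    (ht : IsCosetLeader q n t) {x : ZMod n} (hx : x ∈ cyclotomicCoset q n s)
    (hx' : x ∈ cyclotomicCoset q n t) : s = t :=
  le_antisymm (leader_le hu hs hx hx' ht.1) (leader_le hu ht hx' hx hs.1)

end Orbit

/-! ### Zeros of minimal polynomials -/

section Minpoly

variable {F : Type*} [Field F] [Fintype F] {K : Type*} [Field K] [Algebra F K] {n : ℕ} {β : K}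

lemma mem_range_algebraMap_of_pow_card {c : K} (hc : c ^ Fintype.card F = c) :
    c ∈ Set.range (algebraMap F K) := by
  classical
  by_contra h
  have hq : 1 < Fintype.card F := Fintype.one_lt_card
  have hne : (X ^ Fintype.card F - X : K[X]) ≠ 0 := FiniteField.X_pow_card_sub_X_ne_zero K hq
  set S : Finset K := insert c (Finset.univ.image (algebraMap F K)) with hS
  have hcard : S.card = Fintype.card F + 1 := by
    rw [hS, Finset.card_insert_of_notMem, Finset.card_image_of_injective _ (algebraMap F K).injective,
      Finset.card_univ]
    simpa using h
  have hroots : S.val ⊆ (X ^ Fintype.card F - X : K[X]).roots := by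
    intro y hy
    rw [mem_roots hne]
    have hy : y ∈ S := hy
    rw [hS, Finset.mem_insert, Finset.mem_image] at hy
    rcases hy with rfl | ⟨a, -, rfl⟩
    · simp [hc]
    · simp [← map_pow, FiniteField.pow_card]
  have := card_le_degree_of_subset_roots hroots
  rw [FiniteField.X_pow_card_sub_X_natDegree_eq K hq, hcard] at this
  omega

lemma pow_val_natCast (hβ : IsPrimitiveRoot β n) (j : ℕ) : β ^ ((j : ZMod n)).val = β ^ j := by
  rw [ZMod.val_natCast]
  conv_rhs => rw [← Nat.mod_add_div j n, pow_add, pow_mul, hβ.pow_eq_one, one_pow, mul_one]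

lemma aeval_pow_card_eq_zero {p : F[X]} {y : K} (h : aeval y p = 0) (k : ℕ) :
    aeval (y ^ Fintype.card F ^ k) p = 0 := by
  induction k with
  | zero => simpa using h
  | succ k ih =>
    have := aeval_algHom_apply (FiniteField.frobeniusAlgHom F K) (y ^ Fintype.card F ^ k) p
    rw [ih, map_zero, FiniteField.coe_frobeniusAlgHom] at this
    rwa [pow_succ, pow_mul]

/-- The product of X - β^y over the coset is fixed by Frobenius, so its coefficients lie in F and
the minimal polynomial divides it. Conversely, Frobenius permutes the roots of a polynomial over F.
-/
lemma aeval_minpoly_pow_eq_zero_iff [NeZero n] (hβ : IsPrimitiveRoot β n)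
    (hu : IsUnit (Fintype.card F : ZMod n)) (i : ℕ) (x : ZMod n) :
    aeval (β ^ x.val) (minpoly F (β ^ i)) = 0 ↔ x ∈ cyclotomicCoset (Fintype.card F) n i := by
  classical
  constructor
  · intro h
    set q := Fintype.card F with hq
    set S : Finset (ZMod n) := (cyclotomicCoset q n i).toFinite.toFinset with hS
    have hmem : ∀ y, y ∈ S ↔ y ∈ cyclotomicCoset q n i := fun y => by simp [hS]
    have hinj : Function.Injective fun y : ZMod n => y * q := fun y z hyz => hu.mul_right_cancel hyz
    have himg : S.image (fun y : ZMod n => y * q) = S := by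
      apply Finset.eq_of_subset_of_card_le
      · intro y hy
        obtain ⟨z, hz, rfl⟩ := Finset.mem_image.1 hy
        obtain ⟨j, rfl⟩ := (hmem z).1 hz
        exact (hmem _).2 ⟨j + 1, by rw [pow_succ, mul_assoc]⟩
      · rw [Finset.card_image_of_injective _ hinj]
    set P : K[X] := ∏ y ∈ S, (X - C (β ^ y.val)) with hP
    have hpow : ∀ y : ZMod n, (β ^ y.val) ^ q = β ^ (y * q).val := fun y => by
      rw [← pow_mul, ← pow_val_natCast hβ (y.val * q)]
      simp
    have hfix : P.map (FiniteField.frobeniusAlgHom F K : K →+* K) = P := by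
      rw [hP, Polynomial.map_prod]
      conv_rhs => rw [← himg, Finset.prod_image hinj.injOn]
      refine Finset.prod_congr rfl fun y _ => ?_
      rw [Polynomial.map_sub, map_X, map_C, ← hpow]
      rfl
    have hlift : P ∈ lifts (algebraMap F K) := by
      rw [lifts_iff_coeff_lifts]
      intro k
      apply mem_range_algebraMap_of_pow_card
      have := congrArg (fun p => coeff p k) hfix
      simp only [coeff_map] at this
      exact this
    obtain ⟨p, hp⟩ := (mem_lifts _).1 hlift
    have hpz : ∀ y : K, aeval y p = eval y P := fun y => by rw [← hp, aeval_def, eval_map]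
    have h1 : aeval (β ^ i) p = 0 := by
      rw [hpz, hP, eval_prod]
      refine Finset.prod_eq_zero ((hmem (i : ZMod n)).2 (mem_coset_self i)) ?_
      rw [eval_sub, eval_X, eval_C, pow_val_natCast hβ, sub_self]
    obtain ⟨r, hr⟩ := minpoly.dvd F (β ^ i) h1
    have h2 : aeval (β ^ x.val) p = 0 := by rw [hr, map_mul, h, zero_mul]
    rw [hpz, hP, eval_prod, Finset.prod_eq_zero_iff] at h2
    obtain ⟨y, hy, h3⟩ := h2
    simp only [eval_sub, eval_X, eval_C, sub_eq_zero] at h3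
    have := ZMod.val_injective n (hβ.pow_inj (ZMod.val_lt _) (ZMod.val_lt _) h3)
    rw [this]
    exact (hmem y).1 hy
  · rintro ⟨j, rfl⟩
    have h1 := aeval_pow_card_eq_zero (minpoly.aeval F (β ^ i)) j
    rw [← pow_mul, ← pow_val_natCast hβ] at h1
    simpa using h1

end Minpoly

/-! ### BCH codes -/

section BCH

variable {F : Type*} [Field F] {K : Type*} [Field K] [Algebra F K] {n : ℕ} {β : K} {δ : ℕ}

lemma bchGenerator_dvd (hβ : IsPrimitiveRoot β n) : bchGenerator F β (δ + 1) 0 ∣ X ^ n - 1 := by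
  classical
  let _ : NormalizedGCDMonoid F[X] := UniqueFactorizationMonoid.toNormalizedGCDMonoid F[X]
  refine Finset.lcm_dvd fun i _ => minpoly.dvd F _ ?_
  have : (β ^ i) ^ n = 1 := by
    rw [← zpow_natCast, ← zpow_mul, mul_comm, zpow_mul, zpow_natCast, hβ.pow_eq_one, one_zpow]
  simp [this]

lemma aeval_bchGenerator_eq_zero_iff (y : K) :
    aeval y (bchGenerator F β (δ + 1) 0) = 0 ↔ ∃ i < δ, aeval y (minpoly F (β ^ i)) = 0 := by
  classical
  let _ : NormalizedGCDMonoid F[X] := UniqueFactorizationMonoid.toNormalizedGCDMonoid F[X]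
  -- With designed distance δ + 1 and first exponent 0, the exponents are exactly 0, ..., δ - 1.
  have hmem : ∀ i : ℤ, i ∈ Finset.Icc (0 : ℤ) (0 + ((δ + 1 : ℕ) : ℤ) - 2) ↔ 0 ≤ i ∧ i < δ :=
    fun i => by rw [Finset.mem_Icc]; push_cast; omega
  constructor
  · intro h
    have hd : bchGenerator F β (δ + 1) 0 ∣
        ∏ i ∈ Finset.Icc (0 : ℤ) (0 + ((δ + 1 : ℕ) : ℤ) - 2), minpoly F (β ^ i) :=
      Finset.lcm_dvd fun i hi => Finset.dvd_prod_of_mem _ hi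
    obtain ⟨r, hr⟩ := hd
    have h1 := congrArg (aeval y) hr
    rw [map_mul, h, zero_mul, map_prod, Finset.prod_eq_zero_iff] at h1
    obtain ⟨i, hi, h2⟩ := h1
    rw [hmem] at hi
    obtain ⟨k, rfl⟩ := Int.eq_ofNat_of_zero_le hi.1
    exact ⟨k, by omega, by simpa using h2⟩
  · rintro ⟨i, hi, h⟩
    have hd : minpoly F (β ^ (i : ℤ)) ∣ bchGenerator F β (δ + 1) 0 :=
      Finset.dvd_lcm ((hmem i).2 (by omega))
    rw [zpow_natCast] at hd
    obtain ⟨r, hr⟩ := hd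
    rw [hr, map_mul, h, zero_mul]

variable [Fintype F]

lemma finrank_bchCode (hβ : IsPrimitiveRoot β n) (hn0 : (n : F) ≠ 0)
    (hu : IsUnit (Fintype.card F : ZMod n)) :
    Module.finrank F (bchCode F n β (δ + 1) 0) =
      Set.ncard {x : ZMod n | ∀ i < δ, x ∉ cyclotomicCoset (Fintype.card F) n i} := by
  have : NeZero n := ⟨by rintro rfl; simp at hn0⟩
  rw [bchCode, finrank_cyclicCode_eq_ncard hn0 hβ (bchGenerator_dvd hβ)]
  congr 1
  ext x
  simp only [Set.mem_ofPred_eq, ne_eq, aeval_bchGenerator_eq_zero_iff,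
    aeval_minpoly_pow_eq_zero_iff hβ hu]
  push Not
  rfl

variable {m : ℕ}

lemma aeval_inv_eq_zero (hn : n = Fintype.card F ^ m + 1) {y : K}
    (hy : y ^ n = 1) {p : F[X]} (h : aeval y p = 0) : aeval y⁻¹ p = 0 := by
  have h1 := aeval_pow_card_eq_zero h m
  have h2 : y ^ Fintype.card F ^ m = y⁻¹ := by
    apply eq_inv_of_mul_eq_one_left
    rw [← pow_succ, ← hn, hy]
  rwa [h2] at h1

lemma isLCD_bchCode (hβ : IsPrimitiveRoot β n) (hn : n = Fintype.card F ^ m + 1) :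
    IsLCD (bchCode F n β (δ + 1) 0) := by
  refine isLCD_cyclicCode (by omega) hβ (bchGenerator_dvd hβ) fun l h => ?_
  have := aeval_inv_eq_zero hn (y := (β ^ l)⁻¹) (by
    rw [inv_pow, ← pow_mul, mul_comm, pow_mul, hβ.pow_eq_one, one_pow, inv_one]) h
  rwa [inv_inv] at this

/-- The zeros β^i with |i| ≤ δ - 1 are 2δ - 1 consecutive powers. Positive dimension is required
because `minDist` is 0 on the zero code. -/
lemma le_minDist_bchCode (hβ : IsPrimitiveRoot β n) (hn : n = Fintype.card F ^ m + 1)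
    (hδ : 0 < δ) (hpos : 0 < Module.finrank F (bchCode F n β (δ + 1) 0)) :
    2 * δ ≤ minDist (bchCode F n β (δ + 1) 0) := by
  classical
  have hn0 : 0 < n := by omega
  have hβ0 : β ≠ 0 := hβ.ne_zero hn0.ne'
  have key : ∀ x ∈ bchCode F n β (δ + 1) 0, x ≠ 0 → 2 * δ ≤ hammingNorm x := fun x hx hx0 => by
    have hdvd := (mem_cyclicCode_iff (bchGenerator_dvd hβ) x).1 hx
    have hz : ∀ i < δ, aeval (β ^ i) (wordPoly F n x) = 0 := fun i hi => by
      obtain ⟨r, hr⟩ := hdvd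
      rw [hr, map_mul, (aeval_bchGenerator_eq_zero_iff _).2 ⟨i, hi, minpoly.aeval F _⟩, zero_mul]
    have hz' : ∀ i < δ, aeval (β ^ i)⁻¹ (wordPoly F n x) = 0 := fun i hi =>
      aeval_inv_eq_zero hn (by rw [← pow_mul, mul_comm, pow_mul, hβ.pow_eq_one, one_pow]) (hz i hi)
    have hlt := bch_bound hβ hn0 (D := 2 * δ - 1) (b := -((δ : ℤ) - 1)) (x := x) (fun j hj => by
      rcases le_or_gt (δ - 1) j with h | h
      · obtain ⟨i, rfl⟩ := Nat.exists_eq_add_of_le h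
        have h1 := hz i (by omega)
        rw [aeval_wordPoly] at h1
        rw [← h1]
        refine Finset.sum_congr rfl fun k _ => ?_
        rw [show -((δ : ℤ) - 1) + ((δ - 1 + i : ℕ) : ℤ) = i by omega, zpow_natCast, ← pow_mul,
          ← pow_mul, mul_comm i]
      · obtain ⟨i, hi⟩ : ∃ i, δ - 1 = j + i := ⟨δ - 1 - j, by omega⟩
        have h1 := hz' i (by omega)
        rw [aeval_wordPoly] at h1
        rw [← h1]
        refine Finset.sum_congr rfl fun k _ => ?_
        rw [show -((δ : ℤ) - 1) + (j : ℤ) = -(i : ℤ) by omega, zpow_neg, zpow_natCast, inv_pow,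
          ← pow_mul, ← pow_mul, mul_comm i]) hx0
    omega
  refine le_csInf ?_ ?_
  · obtain ⟨x, hx⟩ := Module.finrank_pos_iff_exists_ne_zero.1 hpos
    exact ⟨_, x, x.2, 0, Submodule.zero_mem _, by simpa using hx, rfl⟩
  · rintro d ⟨x, hx, y, hy, hxy, rfl⟩
    rw [hammingDist_eq_hammingNorm]
    exact key _ (Submodule.add_mem _ (Submodule.neg_mem _ hx) hy) fun h => hxy (by
      rw [neg_add_eq_zero] at h; exact h)

end BCH

/-! ### Counting -/

lemma isNthLargest_of_eq {q n s i : ℕ} (hs : IsCosetLeader q n s) (S : Finset ℕ)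
    (hS : ∀ t, IsCosetLeader q n t ∧ s ≤ t ↔ t ∈ S) (hi : S.card = i) :
    IsNthLargestCosetLeader q n i s := by
  refine ⟨hs, ?_⟩
  rw [show {t : ℕ | IsCosetLeader q n t ∧ s ≤ t} = (S : Set ℕ) by ext t; exact hS t,
    Set.ncard_coe_finset, hi]

/-- A residue avoids the cosets of all i < δ exactly when the leader of its own coset is at least δ.
-/
lemma ncard_notMem_cosets {q n δ : ℕ} [NeZero n] (hu : IsUnit (q : ZMod n)) (hδ : δ ≤ n)
    (S : Finset ℕ) (hS : ∀ t, IsCosetLeader q n t ∧ δ ≤ t ↔ t ∈ S) :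
    Set.ncard {x : ZMod n | ∀ i < δ, x ∉ cyclotomicCoset q n i} =
      ∑ s ∈ S, (cyclotomicCoset q n s).ncard := by
  classical
  have h1 : {x : ZMod n | ∀ i < δ, x ∉ cyclotomicCoset q n i} =
      ((S.biUnion fun s => (cyclotomicCoset q n s).toFinite.toFinset : Finset (ZMod n)) :
        Set (ZMod n)) := by
    ext x
    simp only [Set.mem_ofPred_eq, Finset.coe_biUnion, Set.mem_iUnion, Set.Finite.coe_toFinset,
      Finset.mem_coe, exists_prop]
    constructor
    · intro h
      obtain ⟨s, hs, hx⟩ := exists_leader hu x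
      exact ⟨s, (hS s).1 ⟨hs, not_lt.1 fun hlt => h s hlt hx⟩, hx⟩
    · rintro ⟨s, hs, hx⟩ i hi hxi
      obtain ⟨hl, hle⟩ := (hS s).2 hs
      have := leader_le hu hl hx hxi (by omega)
      omega
  rw [h1, Set.ncard_coe_finset, Finset.card_biUnion]
  · exact Finset.sum_congr rfl fun s _ => (Set.ncard_eq_toFinset_card _ _).symm
  · intro s hs t ht hst
    change Disjoint _ _
    rw [Finset.disjoint_left]
    intro x hx hx'
    rw [Set.Finite.mem_toFinset] at hx hx'
    exact hst (leader_unique hu ((hS s).2 hs).1 ((hS t).2 ht).1 hx hx')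

end LCDBCH
end

/-! ### Leaders, dimensions and distances combined -/

theorem mainTheorem1 (q m n : ℕ) (hq : IsPrimePow q) (hodd : Odd q)
    (hm : 12 ≤ m) (hm8 : m % 8 = 4) (hn : n = q ^ m + 1) :
    ∃ δ₁ δ₂ δ₃ δ₄ : ℕ,
      ((δ₁ : ℚ) = (n : ℚ) / 2 ∧ (δ₂ : ℚ) = LCDBCH.Delta2 q m ∧
        (δ₃ : ℚ) = LCDBCH.Delta3 q m ∧ (δ₄ : ℚ) = LCDBCH.Delta4 q m) ∧
      (LCDBCH.IsNthLargestCosetLeader q n 1 δ₁ ∧ LCDBCH.IsNthLargestCosetLeader q n 2 δ₂ ∧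
        LCDBCH.IsNthLargestCosetLeader q n 3 δ₃ ∧ LCDBCH.IsNthLargestCosetLeader q n 4 δ₄) ∧
      ((LCDBCH.cyclotomicCoset q n δ₂).ncard = 8 ∧
        (LCDBCH.cyclotomicCoset q n δ₃).ncard = 2 * m ∧
        (LCDBCH.cyclotomicCoset q n δ₄).ncard = 2 * m) ∧
      ∀ (F : Type u) [Field F] [Fintype F] (K : Type v) [Field K] [Algebra F K] (β : K),
        Fintype.card F = q → IsPrimitiveRoot β n →
        ∀ δ : ℕ, δ₄ ≤ δ → δ ≤ δ₁ →
          LCDBCH.IsLCD (LCDBCH.bchCode F n β (δ + 1) 0) ∧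
          2 * δ ≤ LCDBCH.minDist (LCDBCH.bchCode F n β (δ + 1) 0) ∧
          (δ₂ + 1 ≤ δ → δ ≤ δ₁ →
            Module.finrank F (LCDBCH.bchCode F n β (δ + 1) 0) = 8 * 1 - 7) ∧
          (δ₃ + 1 ≤ δ → δ ≤ δ₂ →
            Module.finrank F (LCDBCH.bchCode F n β (δ + 1) 0) = 8 * 2 - 7) ∧
          (δ₄ + 1 ≤ δ → δ ≤ δ₃ →
            Module.finrank F (LCDBCH.bchCode F n β (δ + 1) 0) = 2 * m + 9) ∧
          (δ = δ₄ →
            Module.finrank F (LCDBCH.bchCode F n β (δ + 1) 0) = 4 * m + 9) := by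
  open LCDBCH in
  have hq3 : 3 ≤ q := by
    have := hq.one_lt
    obtain ⟨k, rfl⟩ := hodd
    omega
  obtain ⟨δ₁, δ₂, δ₃, δ₄, hval, ⟨h4, h43, h32, h21⟩, ⟨l1, l2, l3, l4⟩, ⟨c1, c2, c3, c4⟩, hcl⟩ :=
    exists_leaders hodd hq3 hm hm8 hn
  have hn0 : n ≠ 0 := by omega
  have : NeZero n := ⟨hn0⟩
  have hu : IsUnit (q : ZMod n) := by
    rw [ZMod.isUnit_iff_coprime, hn]
    have hc : Nat.Coprime (q ^ m) (q ^ m + 1) := by simp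
    exact Nat.Coprime.coprime_dvd_left (dvd_pow_self q (by omega)) hc
  have hS1 : ∀ δ, δ₂ < δ → δ ≤ δ₁ → ∀ t, IsCosetLeader q n t ∧ δ ≤ t ↔
      t ∈ ({δ₁} : Finset ℕ) := fun δ h h' t => by
    simp only [Finset.mem_singleton]
    constructor
    · rintro ⟨ht, hle⟩
      have := hcl t ht (by omega)
      omega
    · rintro rfl
      exact ⟨l1, h'⟩
  have hS2 : ∀ δ, δ₃ < δ → δ ≤ δ₂ → ∀ t, IsCosetLeader q n t ∧ δ ≤ t ↔
      t ∈ ({δ₁, δ₂} : Finset ℕ) := fun δ h h' t => by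
    simp only [Finset.mem_insert, Finset.mem_singleton]
    constructor
    · rintro ⟨ht, hle⟩
      have := hcl t ht (by omega)
      omega
    · rintro (rfl | rfl)
      · exact ⟨l1, by omega⟩
      · exact ⟨l2, h'⟩
  have hS3 : ∀ δ, δ₄ < δ → δ ≤ δ₃ → ∀ t, IsCosetLeader q n t ∧ δ ≤ t ↔
      t ∈ ({δ₁, δ₂, δ₃} : Finset ℕ) := fun δ h h' t => by
    simp only [Finset.mem_insert, Finset.mem_singleton]
    constructor
    · rintro ⟨ht, hle⟩
      have := hcl t ht (by omega)
      omega
    · rintro (rfl | rfl | rfl)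
      · exact ⟨l1, by omega⟩
      · exact ⟨l2, by omega⟩
      · exact ⟨l3, h'⟩
  have hS4 : ∀ t, IsCosetLeader q n t ∧ δ₄ ≤ t ↔
      t ∈ ({δ₁, δ₂, δ₃, δ₄} : Finset ℕ) := fun t => by
    simp only [Finset.mem_insert, Finset.mem_singleton]
    constructor
    · rintro ⟨ht, hle⟩
      exact hcl t ht hle
    · rintro (rfl | rfl | rfl | rfl)
      · exact ⟨l1, by omega⟩
      · exact ⟨l2, by omega⟩
      · exact ⟨l3, by omega⟩
      · exact ⟨l4, le_rfl⟩
  have n12 : δ₁ ∉ ({δ₂} : Finset ℕ) := by simp; omega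
  have n13 : δ₁ ∉ ({δ₂, δ₃} : Finset ℕ) := by simp; omega
  have n14 : δ₁ ∉ ({δ₂, δ₃, δ₄} : Finset ℕ) := by simp; omega
  have n23 : δ₂ ∉ ({δ₃} : Finset ℕ) := by simp; omega
  have n24 : δ₂ ∉ ({δ₃, δ₄} : Finset ℕ) := by simp; omega
  have n34 : δ₃ ∉ ({δ₄} : Finset ℕ) := by simp; omega
  refine ⟨δ₁, δ₂, δ₃, δ₄, hval,
    ⟨isNthLargest_of_eq l1 _ (hS1 δ₁ h21 le_rfl) (by simp),
      isNthLargest_of_eq l2 _ (hS2 δ₂ h32 le_rfl) (by simp [n12]),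
      isNthLargest_of_eq l3 _ (hS3 δ₃ h43 le_rfl) (by
        rw [Finset.card_insert_of_notMem n13, Finset.card_insert_of_notMem n23,
          Finset.card_singleton]),
      isNthLargest_of_eq l4 _ hS4 (by
        rw [Finset.card_insert_of_notMem n14, Finset.card_insert_of_notMem n24,
          Finset.card_insert_of_notMem n34, Finset.card_singleton])⟩, ⟨c2, c3, c4⟩, ?_⟩
  intro F _ _ K _ _ β hF hβ δ hδ4 hδ1
  subst hF
  have hnF : (n : F) ≠ 0 := by
    rw [hn]; push_cast
    rw [FiniteField.cast_card_eq_zero, zero_pow (by omega), zero_add]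
    exact one_ne_zero
  have hdim : ∀ S : Finset ℕ, (∀ t, IsCosetLeader (Fintype.card F) n t ∧ δ ≤ t ↔ t ∈ S) →
      Module.finrank F (bchCode F n β (δ + 1) 0) =
        ∑ s ∈ S, (cyclotomicCoset (Fintype.card F) n s).ncard := fun S hS => by
    rw [finrank_bchCode hβ hnF hu, ncard_notMem_cosets hu (by have := l1.1; omega) S hS]
  have d1 : δ₂ + 1 ≤ δ → δ ≤ δ₁ → Module.finrank F (bchCode F n β (δ + 1) 0) = 8 * 1 - 7 :=
    fun h h' => by rw [hdim _ (hS1 δ h h'), Finset.sum_singleton, c1]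
  have d2 : δ₃ + 1 ≤ δ → δ ≤ δ₂ → Module.finrank F (bchCode F n β (δ + 1) 0) = 8 * 2 - 7 :=
    fun h h' => by
      rw [hdim _ (hS2 δ h h'), Finset.sum_insert n12, Finset.sum_singleton, c1, c2]
  have d3 : δ₄ + 1 ≤ δ → δ ≤ δ₃ → Module.finrank F (bchCode F n β (δ + 1) 0) = 2 * m + 9 :=
    fun h h' => by
      rw [hdim _ (hS3 δ h h'), Finset.sum_insert n13, Finset.sum_insert n23, Finset.sum_singleton,
        c1, c2, c3]
      ring
  have d4 : δ = δ₄ → Module.finrank F (bchCode F n β (δ + 1) 0) = 4 * m + 9 := fun h => by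
    rw [hdim _ (by rw [h]; exact hS4), Finset.sum_insert n14, Finset.sum_insert n24, Finset.sum_insert n34,
      Finset.sum_singleton, c1, c2, c3, c4]
    ring
  -- The distance bound still needs a nonzero code; the four dimension formulas cover the whole
  -- range of δ.
  refine ⟨isLCD_bchCode hβ hn, le_minDist_bchCode hβ hn (by omega) ?_, d1, d2, d3, d4⟩
  rcases Nat.lt_or_ge δ₂ δ with h | h
  · rw [d1 h hδ1]; norm_num
  rcases Nat.lt_or_ge δ₃ δ with h' | h'
  · rw [d2 h' h]; norm_num
  rcases Nat.lt_or_ge δ₄ δ with h'' | h''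
  · rw [d3 h'' h']; omega
  · rw [d4 (by omega)]; omega
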